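/- **Setting.** A quantum switch has $M$ memory registers, $N$ users, and finitely many requests $r\in\mathcal R=\{1,\dots,R\}$; request $r$ is specified by a non-empty set $\mathcal G(r)$ of users, distinct requests have distinct user sets, and $|\mathcal G(r)|\le M$ for all $r$. Put $\Lambda=\{|\mathcal G(r)|: r\in\mathcal R\}$, $\mathcal C(\lambda)=\{r:|\mathcal G(r)|=\lambda\}$ and $M_\lambda=\min\{|\mathcal C(\lambda)|,\lfloor M/\lambda\rfloor\}$. In each slot $t=1,2,\dots$ a causal (possibly randomized) policy $\pi$ selects a non-empty set of requests whose cardinalities $|\mathcal G(r)|$ sum to at most $M$. For a selected request $r$, each user $i\in\mathcal G(r)$ establishes a link with probability $p_i\in(0,1]$, and if all of them do, the swap succeeds, and $r$ is served, with probability $q_{|\mathcal G(r)|}\in(0,1]$; all these trials are independent. Let $v(r)=\prod_{i\in\mathcal G(r)}p_i$. The age $h^\pi_r(t)$ is $t$ minus the last slot in $\{1,\dots,t-1\}$ in which $r$ was served ($t$ minus $0$ if there is none). Let $$\Delta^\pi=\frac1R\sum_{r=1}^R\limsup_{T\to\infty}\frac1T\sum_{t=1}^T\mathbb E[h_r^\pi(t)],\qquad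 \bar\Delta^\pi=\limsup_{T\to\infty}\frac1{TR}\sum_{r=1}^R\sum_{t=1}^T\mathbb E[h^\pi_r(t)].$$ **SSR policies.** A single-cardinality stationary randomized (SSR) policy $\mu$ consists of a probability distribution $\mu^{(0)}$ on $\Lambda$ and, for each $\lambda\in\Lambda$, numbers $\mu^{(\lambda)}(r)\in[0,1]$, $r\in\mathcal C(\lambda)$, with sum $M_\lambda$. In each slot, independently of the past, it samples $\lambda$ from $\mu^{(0)}$ and then selects $M_\lambda$ requests of $\mathcal C(\lambda)$ without replacement by a fixed sampling procedure that selects $r$ with probability $\mu^{(\lambda)}(r)$. An SSR policy is optimal if it minimizes $\Delta$ over all SSR policies. **SMW policies.** Given an SSR policy $\mu^\star$, a single-cardinality max-weight (SMW) policy $\psi$ samples, in each slot $t$, a cardinality $\lambda$ from $\mu^{\star(0)}$, independently of the past, and then selects $M_\lambda$ requests of $\mathcal C(\lambda)$ with the largest weights $h^\psi_r(t)/\mu^{\star(\lambda)}(r)$, that is, a set $C\subseteq\mathcal C(\lambda)$ with $|C|=M_\lambda$ maximizing $\sum_{r\in C}h_r^\psi(t)/\mu^{\star(\lambda)}(r)$,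 with ties broken by an arbitrary rule, which may be randomized and may depend on the past. **Theorem 2.** (a) An SSR policy $\mu^\star$ is optimal if, for all $\lambda\in\Lambda$ and $r\in\mathcal C(\lambda)$, $$\mu^{\star(\lambda)}(r)=\begin{cases}\min\{1,1/\sqrt{\gamma^{(\lambda)}v(r)}\}&\text{if }M_\lambda<|\mathcal C(\lambda)|,\\1&\text{if }M_\lambda=|\mathcal C(\lambda)|,\end{cases}\qquad \mu^{\star(0)}(\lambda)=\frac{\sqrt{f^\star_\lambda/q_\lambda}}{\sum_{\lambda'\in\Lambda}\sqrt{f^\star_{\lambda'}/q_{\lambda'}}},$$ where $\gamma^{(\lambda)}>0$ is such that $\sum_{r\in\mathcal C(\lambda)}\min\{1,1/\sqrt{\gamma^{(\lambda)}v(r)}\}=M_\lambda$, and $f^\star_\lambda=\sum_{r\in\mathcal C(\lambda)}1/(\mu^{\star(\lambda)}(r)v(r))$. (b) Let $\mu^\star$ be any optimal SSR policy and let $\psi$ be any SMW policy for $\mu^\star$. Then $\bar\Delta^\psi\le\bar\Delta^{\mu^\star}$. If moreover $\psi$ breaks ties on the basis of the current ages only (its selection probabilities in a slot are a function of the vector of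 current ages), then also $\Delta^\psi\le\Delta^{\mu^\star}$. -/

import Mathlib

open scoped NNReal ENNReal
open Filter

noncomputable section

namespace QSwitch

/-- A quantum switch with `N` users, `R` requests and `M` memory registers. -/
structure Switch (N R : ℕ) where
  /-- number of memory registers -/
  M : ℕ
  /-- the set of users of each request -/
  G : Fin R → Finset (Fin N)
  /-- success probability of a link-level entanglement attempt of each user -/
  p : Fin N → ℝ≥0
  /-- success probability of a swap over a given number of users -/
  q : ℕ → ℝ≥0
  G_injective : Function.Injective G
  G_nonempty : ∀ r, (G r).Nonempty
  /-- every single request fits in the memory -/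
  G_le : ∀ r, (G r).card ≤ M
  p_pos : ∀ i, 0 < p i
  p_le : ∀ i, p i ≤ 1
  q_pos : ∀ r, 0 < q (G r).card
  q_le : ∀ r, q (G r).card ≤ 1

/-- The law of a finite family of independent Bernoulli variables. -/
def bernoulliFamily {ι : Type*} [Fintype ι] [DecidableEq ι] (a : ι → ℝ≥0) (ha : ∀ i, a i ≤ 1) :
    PMF (ι → Bool) :=
  PMF.ofFintype (fun ω => ∏ i, ((if ω i then a i else 1 - a i : ℝ≥0) : ℝ≥0∞)) (by
    rw [← Fintype.prod_sum fun i (b : Bool) => ((if b then a i else 1 - a i : ℝ≥0) : ℝ≥0∞)]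
    refine Finset.prod_eq_one fun i _ => ?_
    rw [Fintype.sum_bool, ← ENNReal.coe_add]
    simp [add_tsub_cancel_of_le (ha i)])

/-- What happened in one slot. -/
structure Slot (N R : ℕ) where
  /-- the requests selected for service (`u r = 1` iff `r ∈ sched`) -/
  sched : Finset (Fin R)
  /-- `lle r i`: user `i` established a link-level entanglement for request `r` -/
  lle : Fin R → Fin N → Bool
  /-- the requests that were served (`d r = 1` iff `r ∈ served`) -/
  served : Finset (Fin R)

/-- The slots `1, …, t - 1` that precede slot `t`, the most recent one first; thus `t` is the
length of the history plus one. -/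
abbrev History (N R : ℕ) := List (Slot N R)

/-- The last slot `τ ∈ {1, …, t - 1}` in which request `r` was served, `0` if there is none. -/
def lastServed {N R : ℕ} (r : Fin R) : History N R → ℕ
  | [] => 0
  | s :: H => if r ∈ s.served then H.length + 1 else lastServed r H

/-- The age of request `r` at slot `t`: `t` minus the last slot before `t` with a service of `r`. -/
def age {N R : ℕ} (H : History N R) (r : Fin R) : ℕ := (H.length + 1) - lastServed r H

namespace Switch

variable {N R : ℕ} (S : Switch N R)

/-- The set `Λ` of request cardinalities. -/
def cards : Finset ℕ := Finset.univ.image fun r => (S.G r).card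

/-- `𝒞(l)`, the requests of cardinality `l`. -/
def reqs (l : ℕ) : Finset (Fin R) := Finset.univ.filter fun r => (S.G r).card = l

/-- `M_l = min {|𝒞(l)|, ⌊M / l⌋}`. -/
def cap (l : ℕ) : ℕ := min (S.reqs l).card (S.M / l)

/-- `v(r)`, the probability that all users of a selected request `r` establish a link. -/
def v (r : Fin R) : ℝ≥0 := ∏ i ∈ S.G r, S.p i

/-- Admissible memory configurations: nonempty sets of requests that fit in the memory. -/
def Admissible (x : Finset (Fin R)) : Prop := x.Nonempty ∧ ∑ r ∈ x, (S.G r).card ≤ S.M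

/-- The outcome of a slot with selected set `x`, when `a (r, i)` says whether an attempt of user
`i` for request `r` succeeds and `s r` whether a swap for request `r` succeeds. -/
def outcome (x : Finset (Fin R)) (a : Fin R × Fin N → Bool) (s : Fin R → Bool) : Slot N R where
  sched := x
  lle r i := decide (r ∈ x) && decide (i ∈ S.G r) && a (r, i)
  served := x.filter fun r => (∀ i ∈ S.G r, a (r, i) = true) ∧ s r = true

/-- The law of the outcome of a slot with selected set `x`: all attempts and all swaps are
independent. -/
def serve (x : Finset (Fin R)) : PMF (Slot N R) :=
  (bernoulliFamily (fun ri : Fin R × Fin N => S.p ri.2) (fun ri => S.p_le ri.2)).bind fun a =>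
    (bernoulliFamily (fun r : Fin R => S.q (S.G r).card) S.q_le).map fun s => S.outcome x a s

/-- A causal, possibly randomized scheduling policy: given the past, it selects the requests of
the current slot at random, always within the memory constraint. -/
structure Policy where
  select : History N R → PMF (Finset (Fin R))
  admissible : ∀ H, ∀ x ∈ (select H).support, S.Admissible x

variable {S}

/-- The law of the history of the first `n` slots under a policy. -/
def Policy.law (π : S.Policy) : ℕ → PMF (History N R)
  | 0 => PMF.pure []
  | n + 1 => (π.law n).bind fun H => (π.select H).bind fun x => (S.serve x).map fun s => s :: H

/-- `𝔼[h_r(t)]` at slot `t = n + 1`. -/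
def Policy.meanAge (π : S.Policy) (n : ℕ) (r : Fin R) : ℝ≥0∞ :=
  ∑' H : History N R, π.law n H * (age H r : ℝ≥0∞)

/-- `Δ_r`, the long-term time-average expected age of request `r`; the sum is over the slots
`t = n + 1` from `1` to `T`. -/
def Policy.reqAge (π : S.Policy) (r : Fin R) : ℝ≥0∞ :=
  limsup (fun T : ℕ => (∑ n ∈ Finset.range T, π.meanAge n r) / (T : ℝ≥0∞)) atTop

/-- `Δ`, the mean over the requests of their average ages. -/
def Policy.avgAge (π : S.Policy) : ℝ≥0∞ := (∑ r, π.reqAge r) / (R : ℝ≥0∞)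

/-- The overall objective with a single limit superior:
`limsup (1 / (T R)) ∑_r ∑_{t ≤ T} 𝔼[h_r(t)]`. -/
def Policy.netAge (π : S.Policy) : ℝ≥0∞ :=
  limsup (fun T : ℕ => (∑ r, ∑ n ∈ Finset.range T, π.meanAge n r) / ((T : ℝ≥0∞) * (R : ℝ≥0∞)))
    atTop

/-- The policy selects on the basis of the current ages only. -/
def Policy.IsAgeBased (π : S.Policy) : Prop :=
  ∀ H H' : History N R, age H = age H' → π.select H = π.select H'

variable (S)

/-- A single-cardinality stationary randomized policy: a distribution on the cardinalities, the
marginal selection probabilities in each cardinality class, and a procedure that samples without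
replacement with these marginals. -/
structure SSR where
  /-- `μ⁽⁰⁾` -/
  card : PMF ℕ
  /-- `μ⁽ˡ⁾(r)`, relevant for `r ∈ 𝒞(l)` -/
  marg : ℕ → Fin R → ℝ≥0
  /-- the sampling procedure in each class -/
  sample : ℕ → PMF (Finset (Fin R))
  card_supp : ∀ l ∈ card.support, l ∈ S.cards
  marg_le : ∀ l ∈ S.cards, ∀ r ∈ S.reqs l, marg l r ≤ 1
  marg_sum : ∀ l ∈ S.cards, ∑ r ∈ S.reqs l, marg l r = S.cap l
  sample_supp : ∀ l ∈ S.cards, ∀ x ∈ (sample l).support, x ⊆ S.reqs l ∧ x.card = S.cap l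
  sample_marg : ∀ l ∈ S.cards, ∀ r ∈ S.reqs l,
    ∑ x : Finset (Fin R) with r ∈ x, sample l x = (marg l r : ℝ≥0∞)

variable {S}

theorem admissible_of_subset_reqs {l : ℕ} (hl : l ∈ S.cards) {x : Finset (Fin R)}
    (hx : x ⊆ S.reqs l) (hc : x.card = S.cap l) : S.Admissible x := by
  obtain ⟨r, -, rfl⟩ := Finset.mem_image.1 hl
  have hpos : 0 < (S.G r).card := (S.G_nonempty r).card_pos
  constructor
  · rw [← Finset.card_pos, hc]
    refine lt_min (Finset.card_pos.2 ⟨r, ?_⟩) (Nat.div_pos (S.G_le r) hpos)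
    simp [reqs]
  · have h : ∑ r' ∈ x, (S.G r').card = ∑ r' ∈ x, (S.G r).card :=
      Finset.sum_congr rfl fun r' hr' => (Finset.mem_filter.1 (hx hr')).2
    rw [h, Finset.sum_const, hc, smul_eq_mul]
    exact (Nat.mul_le_mul_right _ (min_le_right _ _)).trans (Nat.div_mul_le_self _ _)

/-- In each slot, sample a cardinality `l` from `μ⁽⁰⁾`, then sample `M_l` requests of `𝒞(l)`. -/
def SSR.toPolicy (μ : S.SSR) : S.Policy where
  select _ := μ.card.bind μ.sample
  admissible _ x hx := by
    obtain ⟨l, hl, hxl⟩ := (PMF.mem_support_bind_iff _ _ _).1 hx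
    have hl' := μ.card_supp l hl
    exact admissible_of_subset_reqs hl' (μ.sample_supp l hl' x hxl).1 (μ.sample_supp l hl' x hxl).2

/-- The policy has the least average age among all SSR policies. -/
def SSR.IsOptimal (μ : S.SSR) : Prop := ∀ μ' : S.SSR, μ.toPolicy.avgAge ≤ μ'.toPolicy.avgAge

/-- `f_l = ∑_{r ∈ 𝒞(l)} 1 / (μ⁽ˡ⁾(r) v(r))`. -/
def SSR.f (μ : S.SSR) (l : ℕ) : ℝ := ∑ r ∈ S.reqs l, 1 / ((μ.marg l r : ℝ) * S.v r)

/-- The closed-form expressions: `μ⁽ˡ⁾(r) = min {1, 1 / √(γ v(r))}` if `M_l < |𝒞(l)|`, with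
`γ > 0` such that these numbers sum to `M_l`; `μ⁽ˡ⁾(r) = 1` if `M_l = |𝒞(l)|`; and `μ⁽⁰⁾(l)` is
proportional to `√(f_l / q_l)`. -/
def SSR.IsClosedForm (μ : S.SSR) : Prop :=
  (∀ l ∈ S.cards, S.cap l < (S.reqs l).card → ∃ γ : ℝ, 0 < γ ∧
    ∑ r ∈ S.reqs l, min 1 (1 / √(γ * S.v r)) = S.cap l ∧
    ∀ r ∈ S.reqs l, (μ.marg l r : ℝ) = min 1 (1 / √(γ * S.v r))) ∧
  (∀ l ∈ S.cards, S.cap l = (S.reqs l).card → ∀ r ∈ S.reqs l, μ.marg l r = 1) ∧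
  ∀ l ∈ S.cards, (μ.card l).toReal = √(μ.f l / S.q l) / ∑ l' ∈ S.cards, √(μ.f l' / S.q l')

/-- `x` consists of `M_l` requests of `𝒞(l)` of largest weights `h_r(t) / μ⁽ˡ⁾(r)`. -/
def SSR.IsMaxWeight (μ : S.SSR) (H : History N R) (l : ℕ) (x : Finset (Fin R)) : Prop :=
  (x ⊆ S.reqs l ∧ x.card = S.cap l) ∧
  ∀ y : Finset (Fin R), y ⊆ S.reqs l → y.card = S.cap l →
    ∑ r ∈ y, (age H r : ℝ) / μ.marg l r ≤ ∑ r ∈ x, (age H r : ℝ) / μ.marg l r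

/-- `ψ` is a single-cardinality max-weight policy with the parameters of `μ`: in each slot it
samples a cardinality `l` from `μ⁽⁰⁾` and then selects `M_l` requests of `𝒞(l)` of largest weights.
Ties are broken arbitrarily, possibly at random and depending on the past. -/
def Policy.IsSMW (ψ : S.Policy) (μ : S.SSR) : Prop :=
  ∃ choice : History N R → ℕ → PMF (Finset (Fin R)),
    (∀ H, ∀ l ∈ S.cards, ∀ x ∈ (choice H l).support, μ.IsMaxWeight H l x) ∧
    ∀ H, ψ.select H = μ.card.bind (choice H)

end Switch

end QSwitch

end

/-!
Under an SSR policy, request `r` is served in each slot with a fixed probability `w r`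
(`SSR.rate`), independently of the past. Its mean age satisfies `m (n + 1) + w m n = m n + 1`, so
that its time average tends to `1 / w r`; thus `Δ` and the variant with a single limit superior
both equal `(1 / R) ∑ r, 1 / w r` (`SSR.avgAge_toPolicy`, `SSR.netAge_toPolicy`). This is
`(1 / R) ∑ l, f_l / (q_l μ⁽⁰⁾(l))`. The closed form minimizes every `f_l`, by the tangent-line
inequality with multiplier `γ` (`one_div_min_le`), and then the sum over `l`, by the
Cauchy-Schwarz inequality (`SSR.IsClosedForm.isOptimal`).

For a max-weight policy with all `w r` positive, the marginals cancel when the maximal weight is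
compared with the mean weight of the sets sampled by the SSR policy. With `s r` the conditional
probability that `r` is served, this gives `∑ h_r ≤ ∑ s_r h_r / w r` (`Policy.IsSMW.sum_age_le`).
Hence the Lyapunov function `∑ h_r / w r` has conditional drift at most `∑ 1 / w r - ∑ h_r`, which
bounds the time averages of `∑ h_r` by those of the SSR policy. If some `w r` vanishes, the SSR
policy has infinite age. Nothing else about `μ` matters for the comparison: it holds for every SSR
policy, optimal or not.

If ties are broken according to the ages, the age vector is a Markov chain on `ℕ^R`, which need
be neither irreducible nor aperiodic. The inequality above and the Cauchy-Schwarz inequality give a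
drift condition for `∑ h_r ^ 2`, so that the averaged laws are tight and the ages uniformly
integrable along them. As in the mean ergodic theorem, a limit point `y` of the averaged laws is
subinvariant, and one averaged law that is close to `y` keeps all later block averages close to `y`;
so the upper time average of each age is at most its mean under `y` (`limsup_cesaro_le_tsum`). The
sum of these means is bounded by Fatou's lemma (`sum_limsup_cesaro_le`).
-/

namespace QSwitch

/-! ### Expectations under discrete laws -/

/-- The expectation of a `[0, ∞]`-valued function under a discrete law. -/
noncomputable def expect {α : Type*} (p : PMF α) (f : α → ℝ≥0∞) : ℝ≥0∞ := ∑' a, p a * f a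

section Expect

variable {α β : Type*}

theorem expect_pure (a : α) (f : α → ℝ≥0∞) : expect (PMF.pure a) f = f a := by
  rw [expect, tsum_eq_single a]
  · simp
  · intro b hb
    simp [PMF.pure_apply, hb]

theorem expect_bind (p : PMF α) (k : α → PMF β) (f : β → ℝ≥0∞) :
    expect (p.bind k) f = expect p fun a => expect (k a) f := by
  simp only [expect, PMF.bind_apply, ← ENNReal.tsum_mul_left, ← ENNReal.tsum_mul_right]
  rw [ENNReal.tsum_comm]
  simp only [mul_assoc]

theorem expect_map (p : PMF α) (g : α → β) (f : β → ℝ≥0∞) :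
    expect (p.map g) f = expect p fun a => f (g a) := by
  rw [PMF.map, expect_bind]
  simp only [Function.comp_apply, expect_pure]

theorem expect_add (p : PMF α) (f g : α → ℝ≥0∞) :
    expect p (fun a => f a + g a) = expect p f + expect p g := by
  simp only [expect, mul_add, ENNReal.tsum_add]

theorem expect_const_mul (p : PMF α) (c : ℝ≥0∞) (f : α → ℝ≥0∞) :
    expect p (fun a => c * f a) = c * expect p f := by
  simp only [expect, ← ENNReal.tsum_mul_left, mul_left_comm]

theorem expect_mul_const (p : PMF α) (f : α → ℝ≥0∞) (c : ℝ≥0∞) :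
    expect p (fun a => f a * c) = expect p f * c := by
  simp only [expect, ← ENNReal.tsum_mul_right, mul_assoc]

theorem expect_const (p : PMF α) (c : ℝ≥0∞) : expect p (fun _ => c) = c := by
  rw [expect, ENNReal.tsum_mul_right, p.tsum_coe, one_mul]

theorem expect_finsetSum {ι : Type*} (p : PMF α) (s : Finset ι) (f : ι → α → ℝ≥0∞) :
    expect p (fun a => ∑ i ∈ s, f i a) = ∑ i ∈ s, expect p (f i) := by
  simp only [expect, Finset.mul_sum]
  exact Summable.tsum_finsetSum fun _ _ => ENNReal.summable

theorem expect_mono_on (p : PMF α) {f g : α → ℝ≥0∞} (h : ∀ a ∈ p.support, f a ≤ g a) :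
    expect p f ≤ expect p g := by
  refine ENNReal.tsum_le_tsum fun a => ?_
  by_cases ha : a ∈ p.support
  · exact mul_le_mul_right (h a ha) _
  · simp [(PMF.apply_eq_zero_iff p a).2 ha]

theorem expect_mono (p : PMF α) {f g : α → ℝ≥0∞} (h : ∀ a, f a ≤ g a) :
    expect p f ≤ expect p g := expect_mono_on p fun a _ => h a

theorem expect_congr_on (p : PMF α) {f g : α → ℝ≥0∞} (h : ∀ a ∈ p.support, f a = g a) :
    expect p f = expect p g :=
  le_antisymm (expect_mono_on p fun a ha => (h a ha).le)
    (expect_mono_on p fun a ha => (h a ha).ge)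

end Expect

section Bernoulli

variable {ι : Type*} [Fintype ι] [DecidableEq ι] (a : ι → ℝ≥0) (ha : ∀ i, a i ≤ 1)

/-- Independence: expectations of products over the coordinates factorize. -/
theorem expect_bernoulliFamily_prod (g : ι → Bool → ℝ≥0∞) :
    expect (bernoulliFamily a ha) (fun ω => ∏ i, g i (ω i)) =
      ∏ i, ((a i : ℝ≥0∞) * g i true + ((1 - a i : ℝ≥0) : ℝ≥0∞) * g i false) := by
  have h : ∀ i, (a i : ℝ≥0∞) * g i true + ((1 - a i : ℝ≥0) : ℝ≥0∞) * g i false =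
      ∑ b : Bool, ((if b then a i else 1 - a i : ℝ≥0) : ℝ≥0∞) * g i b := fun i => by
    simp
  simp only [h]
  rw [Fintype.prod_sum, expect, tsum_fintype]
  simp only [bernoulliFamily, PMF.ofFintype_apply, Finset.prod_mul_distrib]

theorem expect_bernoulliFamily_forall (A : Finset ι) :
    expect (bernoulliFamily a ha) (fun ω => if ∀ i ∈ A, ω i = true then 1 else 0) =
      ∏ i ∈ A, (a i : ℝ≥0∞) := by
  let g : ι → Bool → ℝ≥0∞ := fun i b => if i ∈ A then (if b = true then 1 else 0) else 1
  have h : ∀ ω : ι → Bool, (if ∀ i ∈ A, ω i = true then (1 : ℝ≥0∞) else 0) =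
      ∏ i, g i (ω i) := by
    intro ω
    simp only [g]
    rw [Finset.prod_ite_mem, Finset.univ_inter]
    split_ifs with h
    · exact (Finset.prod_eq_one fun i hi => by simp [h i hi]).symm
    · push Not at h
      obtain ⟨i, hi, hω⟩ := h
      exact (Finset.prod_eq_zero hi (by simp [hω])).symm
  refine (congrArg (expect _) (funext h)).trans ((expect_bernoulliFamily_prod a ha g).trans ?_)
  rw [← Finset.univ_inter A, ← Finset.prod_ite_mem]
  refine Finset.prod_congr rfl fun i _ => ?_
  by_cases hi : i ∈ A
  · simp [g, hi]
  · simp only [g, hi, if_false, mul_one]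
    rw [← ENNReal.coe_add, add_tsub_cancel_of_le (ha i), ENNReal.coe_one]

end Bernoulli

/-! ### Ages and services -/

variable {N R : ℕ}

theorem lastServed_le (r : Fin R) : ∀ H : History N R, lastServed r H ≤ H.length
  | [] => le_rfl
  | s :: H => by
    rw [lastServed]
    split_ifs
    · simp
    · exact (lastServed_le r H).trans (by simp)

theorem age_nil (r : Fin R) : age ([] : History N R) r = 1 := rfl

theorem age_cons (s : Slot N R) (H : History N R) (r : Fin R) :
    age (s :: H) r = if r ∈ s.served then 1 else age H r + 1 := by
  have h := lastServed_le r H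
  rw [age, age, lastServed]
  split_ifs
  · simp
  · rw [List.length_cons]
    omega

namespace Switch

variable (S : Switch N R)

/-- The probability that a selected request `r` is served. -/
noncomputable def success (r : Fin R) : ℝ≥0 := S.v r * S.q (S.G r).card

theorem v_pos (r : Fin R) : 0 < S.v r := Finset.prod_pos fun i _ => S.p_pos i

theorem success_pos (r : Fin R) : 0 < S.success r := mul_pos (S.v_pos r) (S.q_pos r)

theorem expect_serve (x : Finset (Fin R)) (r : Fin R) :
    expect (S.serve x) (fun s => if r ∈ s.served then 1 else 0) =
      S.success r * if r ∈ x then 1 else 0 := by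
  have hlink := expect_bernoulliFamily_forall (fun ri : Fin R × Fin N => S.p ri.2)
    (fun ri => S.p_le ri.2) ((S.G r).map ⟨fun i => (r, i), Prod.mk_right_injective r⟩)
  have hswap := expect_bernoulliFamily_forall (fun r : Fin R => S.q (S.G r).card) S.q_le {r}
  rw [Finset.prod_map] at hlink
  simp only [Finset.mem_map, Function.Embedding.coeFn_mk, forall_exists_index, and_imp,
    forall_apply_eq_imp_iff₂] at hlink
  simp only [Finset.mem_singleton, forall_eq, Finset.prod_singleton] at hswap
  rw [serve, expect_bind]
  simp only [expect_map, outcome, Finset.mem_filter]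
  by_cases hx : r ∈ x
  · have hsplit : ∀ (a : Fin R × Fin N → Bool) (s : Fin R → Bool),
        (if (∀ i ∈ S.G r, a (r, i) = true) ∧ s r = true then (1 : ℝ≥0∞) else 0) =
          (if ∀ i ∈ S.G r, a (r, i) = true then 1 else 0) * if s r = true then 1 else 0 :=
      fun a s => by rw [ite_zero_mul_ite_zero, mul_one]
    simp only [hx, true_and, hsplit, expect_const_mul, expect_mul_const, hlink, hswap, if_true,
      mul_one, success, v, ENNReal.coe_mul, ENNReal.ofNNReal_finsetProd]
  · simp [hx, expect_const]

variable {S}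

/-- The law of the outcome of the current slot, given the past. -/
noncomputable def Policy.next (π : S.Policy) (H : History N R) : PMF (Slot N R) :=
  (π.select H).bind S.serve

/-- The probability that request `r` is served in the current slot, given the past. -/
noncomputable def Policy.serviceProb (π : S.Policy) (H : History N R) (r : Fin R) : ℝ≥0∞ :=
  expect (π.next H) fun s => if r ∈ s.served then 1 else 0

theorem Policy.serviceProb_eq (π : S.Policy) (H : History N R) (r : Fin R) :
    π.serviceProb H r =
      S.success r * expect (π.select H) fun x => if r ∈ x then 1 else 0 := by
  rw [Policy.serviceProb, Policy.next, expect_bind]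
  simp only [expect_serve, expect_const_mul]

theorem Policy.serviceProb_le_one (π : S.Policy) (H : History N R) (r : Fin R) :
    π.serviceProb H r ≤ 1 := by
  refine (expect_mono _ fun s => ?_).trans (expect_const (π.next H) 1).le
  split_ifs <;> simp

theorem Policy.law_succ (π : S.Policy) (n : ℕ) :
    π.law (n + 1) = (π.law n).bind fun H => (π.next H).map fun s => s :: H := by
  rw [Policy.law]
  simp only [Policy.next, PMF.map_bind]

theorem Policy.expect_law_succ (π : S.Policy) (n : ℕ) (F : History N R → ℝ≥0∞) :
    expect (π.law (n + 1)) F =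
      expect (π.law n) fun H => expect (π.next H) fun s => F (s :: H) := by
  rw [Policy.law_succ, expect_bind]
  simp only [expect_map]

theorem Policy.expect_law_zero (π : S.Policy) (F : History N R → ℝ≥0∞) :
    expect (π.law 0) F = F [] := expect_pure _ _

theorem Policy.meanAge_eq (π : S.Policy) (n : ℕ) (r : Fin R) :
    π.meanAge n r = expect (π.law n) fun H => (age H r : ℝ≥0∞) := rfl

/-- The one-step evolution of a function of the age of `r`, in subtraction-free form. -/
theorem Policy.expect_next_age (π : S.Policy) (H : History N R) (r : Fin R) (φ : ℕ → ℝ≥0∞) :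
    (expect (π.next H) fun s => φ (age (s :: H) r)) + π.serviceProb H r * φ (age H r + 1) =
      π.serviceProb H r * φ 1 + φ (age H r + 1) := by
  rw [Policy.serviceProb, ← expect_mul_const, ← expect_mul_const, ← expect_add,
    ← expect_const (π.next H) (φ (age H r + 1)), ← expect_add]
  simp only [expect_const]
  congr 1
  funext s
  rw [age_cons]
  split_ifs <;> simp [add_comm]

theorem Policy.expect_next_age_id (π : S.Policy) (H : History N R) (r : Fin R) :
    (expect (π.next H) fun s => (age (s :: H) r : ℝ≥0∞)) + π.serviceProb H r * age H r =
      age H r + 1 := by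
  have h := π.expect_next_age H r fun n => (n : ℝ≥0∞)
  have hne : π.serviceProb H r ≠ ∞ := ((π.serviceProb_le_one H r).trans_lt ENNReal.one_lt_top).ne
  push_cast at h
  rw [mul_add, mul_one, ← add_assoc, add_comm (π.serviceProb H r)] at h
  exact (ENNReal.add_left_inj hne).1 h

/-- A Lyapunov function `F` whose conditional drift is at most `C - G` bounds the partial sums of
the expectations of `G`. -/
theorem Policy.sum_expect_le_of_drift (π : S.Policy) {F G : History N R → ℝ≥0∞} {C : ℝ≥0∞}
    (h : ∀ H, (expect (π.next H) fun s => F (s :: H)) + G H ≤ F H + C) (T : ℕ) :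
    ∑ n ∈ Finset.range T, expect (π.law n) G ≤ F [] + T * C := by
  suffices expect (π.law T) F + ∑ n ∈ Finset.range T, expect (π.law n) G ≤ F [] + T * C from
    le_add_self.trans this
  induction T with
  | zero => simp [Policy.expect_law_zero]
  | succ T ih =>
    rw [Finset.sum_range_succ, Policy.expect_law_succ]
    calc _ = (expect (π.law T) fun H => (expect (π.next H) fun s => F (s :: H)) + G H) +
            ∑ n ∈ Finset.range T, expect (π.law n) G := by rw [expect_add]; ring
      _ ≤ (expect (π.law T) fun H => F H + C) + ∑ n ∈ Finset.range T, expect (π.law n) G := by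
        gcongr
        exact expect_mono _ h
      _ = (expect (π.law T) F + ∑ n ∈ Finset.range T, expect (π.law n) G) + C := by
        rw [expect_add, expect_const]; ring
      _ ≤ F [] + T * C + C := by gcongr
      _ = _ := by push_cast; ring

end Switch

/-! ### Time averages of Markov chains -/

/-- Push a measure on `X`, given by its point masses, through a Markov kernel. -/
noncomputable def push {X : Type*} (k : X → PMF X) (m : X → ℝ≥0∞) (x : X) : ℝ≥0∞ :=
  ∑' z, m z * k z x

section Chain

variable {X : Type*} (k : X → PMF X)

theorem push_mono {m m' : X → ℝ≥0∞} (h : m ≤ m') : push k m ≤ push k m' := fun _ =>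
  ENNReal.tsum_le_tsum fun z => mul_le_mul_left (h z) _

theorem push_add (m m' : X → ℝ≥0∞) : push k (m + m') = push k m + push k m' := by
  funext x
  simp only [push, Pi.add_apply, add_mul, ENNReal.tsum_add]

theorem tsum_push (m : X → ℝ≥0∞) : ∑' x, push k m x = ∑' x, m x := by
  simp only [push]
  rw [ENNReal.tsum_comm]
  simp only [ENNReal.tsum_mul_left, PMF.tsum_coe, mul_one]

theorem push_iterate_le {y : X → ℝ≥0∞} (hy : push k y ≤ y) {m r : X → ℝ≥0∞} (hm : m ≤ y + r)
    (j : ℕ) : ∃ r' : X → ℝ≥0∞, (push k)^[j] m ≤ y + r' ∧ ∑' x, r' x = ∑' x, r x := by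
  induction j with
  | zero => exact ⟨r, hm, rfl⟩
  | succ j ih =>
    obtain ⟨r', h, hr⟩ := ih
    refine ⟨push k r', ?_, by rw [tsum_push, hr]⟩
    rw [Function.iterate_succ_apply']
    refine (push_mono k h).trans ?_
    rw [push_add]
    exact add_le_add_left hy _

variable {k}

/-- The point masses of the average of the first `T` laws. -/
noncomputable def cesaro (p : ℕ → PMF X) (T : ℕ) (x : X) : ℝ≥0∞ :=
  (∑ n ∈ Finset.range T, p n x) / T

theorem tsum_cesaro_mul (p : ℕ → PMF X) (T : ℕ) (f : X → ℝ≥0∞) :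
    ∑' x, cesaro p T x * f x = (∑ n ∈ Finset.range T, expect (p n) f) / T := by
  simp only [cesaro, expect, div_eq_mul_inv]
  rw [← Summable.tsum_finsetSum fun _ _ => ENNReal.summable, ← ENNReal.tsum_mul_right]
  refine tsum_congr fun x => ?_
  rw [mul_right_comm, Finset.sum_mul]

theorem push_cesaro {p : ℕ → PMF X} (hp : ∀ n, p (n + 1) = (p n).bind k) (T : ℕ) (x : X) :
    push k (cesaro p T) x = (∑ n ∈ Finset.range T, p (n + 1) x) / T := by
  rw [push, tsum_cesaro_mul]
  simp only [hp, PMF.bind_apply, expect]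

theorem push_iterate_cesaro {p : ℕ → PMF X} (hp : ∀ n, p (n + 1) = (p n).bind k) (T j : ℕ) :
    (push k)^[j] (cesaro p T) = cesaro (fun n => p (n + j)) T := by
  induction j with
  | zero => rfl
  | succ j ih =>
    rw [Function.iterate_succ_apply', ih]
    funext x
    rw [push_cesaro fun n => by rw [← hp, add_right_comm]]
    simp only [cesaro, add_assoc, add_comm 1 j]

/-- Fatou's lemma for sums, along an arbitrary filter. -/
theorem tsum_mul_le_of_tendsto {ι : Type*} {l : Filter ι} [l.NeBot] {a : ι → X → ℝ≥0∞}
    {y : X → ℝ≥0∞} (hy : ∀ x, Tendsto (fun i => a i x) l (nhds (y x))) {f : X → ℝ≥0∞}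
    (hf : ∀ x, f x ≠ ∞) {b : ι → ℝ≥0∞} {B : ℝ≥0∞} (hb : Tendsto b l (nhds B))
    (h : ∀ᶠ i in l, ∑' x, a i x * f x ≤ b i) : ∑' x, y x * f x ≤ B := by
  rw [ENNReal.tsum_eq_iSup_sum]
  refine iSup_le fun s => ?_
  refine le_of_tendsto_of_tendsto
    (tendsto_finsetSum s fun x _ => ENNReal.Tendsto.mul_const (hy x) (Or.inr (hf x))) hb ?_
  filter_upwards [h] with i hi
  exact (ENNReal.sum_le_tsum s).trans hi

theorem tendsto_const_div_natCast {c : ℝ≥0∞} (hc : c ≠ ∞) :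
    Tendsto (fun T : ℕ => c / (T : ℝ≥0∞)) atTop (nhds 0) := by
  have h := ENNReal.Tendsto.const_mul (a := c) ENNReal.tendsto_inv_nat_nhds_zero (Or.inr hc)
  simpa [div_eq_mul_inv] using h

/-- If every block of `n` consecutive terms has average at most `b`, so does the whole sequence,
asymptotically. -/
theorem limsup_cesaro_le_of_blocks {e : ℕ → ℝ≥0∞} {n : ℕ} (hn : 0 < n) {b : ℝ≥0∞}
    (h : ∀ j, ∑ m ∈ Finset.range n, e (m + j) ≤ n * b) :
    limsup (fun T : ℕ => (∑ m ∈ Finset.range T, e m) / (T : ℝ≥0∞)) atTop ≤ b := by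
  rcases eq_or_ne b ∞ with rfl | hb
  · exact le_top
  have hblock : ∀ q : ℕ, ∑ m ∈ Finset.range (n * q), e m ≤ ((n * q : ℕ) : ℝ≥0∞) * b := by
    intro q
    induction q with
    | zero => simp
    | succ q ih =>
      rw [mul_add_one, Finset.sum_range_add]
      refine (add_le_add ih ?_).trans (b := ((n * q : ℕ) : ℝ≥0∞) * b + n * b) ?_
      · simpa only [add_comm] using h (n * q)
      · push_cast
        rw [add_mul]
  have hbound : ∀ T : ℕ, 0 < T →
      (∑ m ∈ Finset.range T, e m) / (T : ℝ≥0∞) ≤ b + n * b / T := by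
    intro T hT
    have hT0 : (T : ℝ≥0∞) ≠ 0 := by exact_mod_cast hT.ne'
    have hle : T ≤ n * (T / n + 1) := (Nat.lt_mul_div_succ T hn).le
    have hge : n * (T / n + 1) ≤ T + n := by
      rw [mul_add_one]
      exact Nat.add_le_add_right (Nat.mul_div_le T n) n
    rw [ENNReal.div_le_iff hT0 (ENNReal.natCast_ne_top T), add_mul,
      ENNReal.div_mul_cancel hT0 (ENNReal.natCast_ne_top T)]
    calc ∑ m ∈ Finset.range T, e m ≤ ∑ m ∈ Finset.range (n * (T / n + 1)), e m :=
          Finset.sum_le_sum_of_subset (Finset.range_mono hle)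
      _ ≤ ((n * (T / n + 1) : ℕ) : ℝ≥0∞) * b := hblock _
      _ ≤ ((T + n : ℕ) : ℝ≥0∞) * b := by gcongr
      _ = _ := by push_cast; ring
  have hlim : Tendsto (fun T : ℕ => b + n * b / (T : ℝ≥0∞)) atTop (nhds (b + 0)) :=
    tendsto_const_nhds.add
      (tendsto_const_div_natCast (ENNReal.mul_ne_top (ENNReal.natCast_ne_top n) hb))
  rw [add_zero] at hlim
  rw [← hlim.limsup_eq]
  refine limsup_le_limsup ?_
  filter_upwards [eventually_gt_atTop 0] with T hT using hbound T hT

/-- Pointwise limits of the averaged laws of a chain, along any filter finer than `atTop`, are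
subinvariant. -/
theorem push_le_of_tendsto_cesaro {p : ℕ → PMF X} (hp : ∀ n, p (n + 1) = (p n).bind k)
    {l : Filter ℕ} [l.NeBot] (hl : l ≤ atTop) {y : X → ℝ≥0∞}
    (hy : ∀ x, Tendsto (fun T => cesaro p T x) l (nhds (y x))) : push k y ≤ y := by
  intro x
  have hb : Tendsto (fun T : ℕ => cesaro p T x + 1 / (T : ℝ≥0∞)) l (nhds (y x + 0)) :=
    (hy x).add ((tendsto_const_div_natCast ENNReal.one_ne_top).mono_left hl)
  rw [add_zero] at hb
  refine tsum_mul_le_of_tendsto hy (fun z => ((k z).coe_le_one x |>.trans_lt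
    ENNReal.one_lt_top).ne) hb (Eventually.of_forall fun T => ?_)
  have h := push_cesaro hp T x
  rw [push] at h
  rw [h, cesaro, ← ENNReal.add_div]
  gcongr
  calc ∑ n ∈ Finset.range T, p (n + 1) x ≤ ∑ n ∈ Finset.range (T + 1), p n x := by
        rw [Finset.sum_range_succ' (fun n => p n x)]
        exact le_self_add
    _ ≤ _ := by
        rw [Finset.sum_range_succ]
        gcongr
        exact (p T).coe_le_one x

/-- Tightness turns pointwise convergence of the averaged laws into an upper bound up to a measure
of small mass. -/
theorem exists_cesaro_le_add {p : ℕ → PMF X} {V : X → ℝ≥0∞}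
    (hV : ∀ L : ℕ, {x | V x ≤ L}.Finite) {C : ℝ≥0∞} (hC : C ≠ ∞)
    (hpV : ∀ T : ℕ, 0 < T → ∑' x, cesaro p T x * V x ≤ C) {l : Filter ℕ} [l.NeBot]
    (hl : l ≤ atTop) {y : X → ℝ≥0∞}
    (hy : ∀ x, Tendsto (fun T => cesaro p T x) l (nhds (y x))) {ε : ℝ≥0∞} (hε : ε ≠ 0) :
    ∃ n, 0 < n ∧ ∃ r : X → ℝ≥0∞, cesaro p n ≤ y + r ∧ ∑' x, r x ≤ ε := by
  classical
  have hε2 : ε / 2 ≠ 0 := by simpa using hε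
  obtain ⟨L, hL⟩ : ∃ L : ℕ, C / ((L + 1 : ℕ) : ℝ≥0∞) < ε / 2 :=
    (((tendsto_add_atTop_iff_nat 1).2 (tendsto_const_div_natCast hC)).eventually
      (gt_mem_nhds (pos_iff_ne_zero.2 hε2))).exists
  set F := (hV (L + 1)).toFinset with hF
  have hsum : Tendsto (fun T => ∑ x ∈ F, (cesaro p T x - y x)) l
      (nhds (∑ x ∈ F, (y x - y x))) := by
    refine tendsto_finsetSum F fun x _ => ?_
    have hyx : y x ≠ ∞ := by
      refine ((le_of_tendsto (hy x) ?_).trans_lt ENNReal.one_lt_top).ne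
      filter_upwards [hl (eventually_gt_atTop 0)] with T hT
      have hT0 : (T : ℝ≥0∞) ≠ 0 := by exact_mod_cast hT.ne'
      rw [cesaro, ENNReal.div_le_iff hT0 (ENNReal.natCast_ne_top T), one_mul]
      exact (Finset.sum_le_sum fun n _ => (p n).coe_le_one x).trans (by simp)
    exact ENNReal.Tendsto.sub (hy x) tendsto_const_nhds (Or.inl hyx)
  simp only [tsub_self, Finset.sum_const_zero] at hsum
  obtain ⟨n, hn, hn0⟩ := ((hsum.eventually (gt_mem_nhds (pos_iff_ne_zero.2 hε2))).and
    (hl (eventually_gt_atTop 0))).exists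
  refine ⟨n, hn0, fun x => cesaro p n x - y x, fun x => le_add_tsub, ?_⟩
  have hpt : ∀ x, cesaro p n x - y x ≤ (if x ∈ F then cesaro p n x - y x else 0) +
      cesaro p n x * V x / ((L + 1 : ℕ) : ℝ≥0∞) := by
    intro x
    by_cases hx : x ∈ F
    · simp [hx]
    · have hVx : ((L + 1 : ℕ) : ℝ≥0∞) ≤ V x := by
        rw [hF, Set.Finite.mem_toFinset, Set.mem_ofPred_eq, not_le] at hx
        exact_mod_cast hx.le
      simp only [hx, if_false, zero_add]
      refine tsub_le_self.trans ?_
      rw [ENNReal.le_div_iff_mul_le (Or.inl (by simp)) (Or.inl (ENNReal.natCast_ne_top _))]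
      gcongr
  refine (ENNReal.tsum_le_tsum hpt).trans ?_
  rw [ENNReal.tsum_add, ← ENNReal.add_halves ε]
  refine add_le_add ?_ ?_
  · rw [tsum_eq_sum (s := F) fun x hx => if_neg hx]
    refine le_trans (Finset.sum_le_sum fun x hx => ?_) hn.le
    rw [if_pos hx]
  · simp only [div_eq_mul_inv _ (((L + 1 : ℕ) : ℝ≥0∞)), ENNReal.tsum_mul_right]
    refine le_trans ?_ hL.le
    rw [div_eq_mul_inv]
    gcongr
    exact hpV n hn0

/-- A limit point of the averaged laws dominates the upper time averages of every function whose
square is dominated by the tightness function `V`. -/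
theorem limsup_cesaro_le_tsum {p : ℕ → PMF X} (hp : ∀ n, p (n + 1) = (p n).bind k)
    {V : X → ℝ≥0∞} (hV : ∀ L : ℕ, {x | V x ≤ L}.Finite) {C : ℝ≥0∞} (hC : C ≠ ∞)
    (hpV : ∀ T : ℕ, 0 < T → ∑' x, cesaro p T x * V x ≤ C) {l : Filter ℕ} [l.NeBot]
    (hl : l ≤ atTop) {y : X → ℝ≥0∞}
    (hy : ∀ x, Tendsto (fun T => cesaro p T x) l (nhds (y x))) {f : X → ℝ≥0∞}
    (hf : ∀ x, f x ^ 2 ≤ V x) :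
    limsup (fun T : ℕ => (∑ n ∈ Finset.range T, expect (p n) f) / (T : ℝ≥0∞)) atTop ≤
      ∑' x, y x * f x := by
  have hinv := push_le_of_tendsto_cesaro hp hl hy
  -- the truncation of `f` at level `K` is bounded, so a measure of small mass contributes little
  have htrunc : ∀ K : ℕ, ∀ ε : ℝ≥0∞, ε ≠ 0 → limsup (fun T : ℕ => (∑ n ∈ Finset.range T,
      expect (p n) fun x => min (f x) K) / (T : ℝ≥0∞)) atTop ≤ ∑' x, y x * f x + ε * K := by
    intro K ε hε
    obtain ⟨n, hn, r, hr, hrε⟩ := exists_cesaro_le_add hV hC hpV hl hy hε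
    refine limsup_cesaro_le_of_blocks hn fun j => ?_
    have hn0 : (n : ℝ≥0∞) ≠ 0 := by exact_mod_cast hn.ne'
    obtain ⟨r', hr', hrr⟩ := push_iterate_le k hinv hr j
    rw [push_iterate_cesaro hp] at hr'
    rw [mul_comm, ← ENNReal.div_le_iff hn0 (ENNReal.natCast_ne_top n),
      ← tsum_cesaro_mul (fun m => p (m + j))]
    calc ∑' x, cesaro (fun m => p (m + j)) n x * min (f x) K
        ≤ ∑' x, (y x * f x + r' x * K) := by
          refine ENNReal.tsum_le_tsum fun x => ?_
          refine (mul_le_mul_left (hr' x) _).trans ?_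
          rw [Pi.add_apply, add_mul]
          gcongr
          · exact min_le_left _ _
          · exact min_le_right _ _
      _ = ∑' x, y x * f x + (∑' x, r' x) * K := by rw [ENNReal.tsum_add, ENNReal.tsum_mul_right]
      _ ≤ _ := by rw [hrr]; gcongr
  have hK : ∀ K : ℕ, 0 < K → limsup (fun T : ℕ => (∑ n ∈ Finset.range T, expect (p n) f) /
      (T : ℝ≥0∞)) atTop ≤ ∑' x, y x * f x + C / K := by
    intro K hK
    have hK0 : (K : ℝ≥0∞) ≠ 0 := by exact_mod_cast hK.ne'
    have hKt : (K : ℝ≥0∞) ≠ ∞ := ENNReal.natCast_ne_top K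
    have hlim : limsup (fun T : ℕ => (∑ n ∈ Finset.range T,
        expect (p n) fun x => min (f x) K) / (T : ℝ≥0∞)) atTop ≤ ∑' x, y x * f x := by
      refine ENNReal.le_of_forall_pos_le_add fun ε hε _ => ?_
      have h := htrunc K (ε / K) (by simp [hε.ne', hKt])
      rwa [ENNReal.div_mul_cancel hK0 hKt] at h
    have hpt : ∀ x, f x ≤ min (f x) K + V x * (K : ℝ≥0∞)⁻¹ := by
      intro x
      rcases le_total (f x) K with h | h
      · rw [min_eq_left h]
        exact le_self_add
      · refine le_add_left ?_
        rw [← div_eq_mul_inv, ENNReal.le_div_iff_mul_le (Or.inl hK0) (Or.inl hKt)]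
        refine le_trans ?_ (hf x)
        rw [sq]
        gcongr
    have hstep : ∀ T : ℕ, 0 < T → (∑ n ∈ Finset.range T, expect (p n) f) / (T : ℝ≥0∞) ≤
        (∑ n ∈ Finset.range T, expect (p n) fun x => min (f x) K) / (T : ℝ≥0∞) + C / K := by
      intro T hT
      rw [← tsum_cesaro_mul, ← tsum_cesaro_mul]
      calc ∑' x, cesaro p T x * f x
          ≤ ∑' x, (cesaro p T x * min (f x) K + cesaro p T x * V x * (K : ℝ≥0∞)⁻¹) := by
            refine ENNReal.tsum_le_tsum fun x => ?_
            rw [mul_assoc, ← mul_add]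
            gcongr
            exact hpt x
        _ ≤ _ := by
            rw [ENNReal.tsum_add, ENNReal.tsum_mul_right, div_eq_mul_inv]
            gcongr
            exact hpV T hT
    calc _ ≤ limsup (fun T : ℕ => (∑ n ∈ Finset.range T,
          expect (p n) fun x => min (f x) K) / (T : ℝ≥0∞) + C / K) atTop := by
          refine limsup_le_limsup ?_
          filter_upwards [eventually_gt_atTop 0] with T hT using hstep T hT
      _ ≤ _ := by
          rw [limsup_add_const atTop _ _ (by isBoundedDefault) (by isBoundedDefault)]
          gcongr
  have hlim : Tendsto (fun K : ℕ => ∑' x, y x * f x + C / (K : ℝ≥0∞)) atTop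
      (nhds (∑' x, y x * f x + 0)) := tendsto_const_nhds.add (tendsto_const_div_natCast hC)
  rw [add_zero] at hlim
  refine ge_of_tendsto hlim ?_
  filter_upwards [eventually_gt_atTop 0] with K hK0 using hK K hK0

/-- For a Markov chain with time averages of second moments bounded, the sum of the upper time
averages of finitely many functions is at most any bound on the time averages of their sum. -/
theorem sum_limsup_cesaro_le {p : ℕ → PMF X} (hp : ∀ n, p (n + 1) = (p n).bind k)
    {V : X → ℝ≥0∞} (hV : ∀ L : ℕ, {x | V x ≤ L}.Finite) {C : ℝ≥0∞} (hC : C ≠ ∞)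
    (hpV : ∀ T : ℕ, 0 < T → (∑ n ∈ Finset.range T, expect (p n) V) / (T : ℝ≥0∞) ≤ C)
    {ι : Type*} [Fintype ι] {f : ι → X → ℝ≥0∞} (hf : ∀ i x, f i x ^ 2 ≤ V x)
    (hft : ∀ i x, f i x ≠ ∞) {b : ℕ → ℝ≥0∞} {B : ℝ≥0∞} (hb : Tendsto b atTop (nhds B))
    (h : ∀ T : ℕ, 0 < T →
      (∑ n ∈ Finset.range T, expect (p n) fun x => ∑ i, f i x) / (T : ℝ≥0∞) ≤ b T) :
    ∑ i, limsup (fun T : ℕ => (∑ n ∈ Finset.range T, expect (p n) (f i)) / (T : ℝ≥0∞)) atTop ≤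
      B := by
  have hl : (hyperfilter ℕ : Filter ℕ) ≤ atTop := by
    rw [← Nat.cofinite_eq_atTop]
    exact hyperfilter_le_cofinite
  -- by compactness of `[0, ∞]` all point masses converge along an ultrafilter
  have hex : ∀ x, ∃ z, Tendsto (fun T => cesaro p T x) (hyperfilter ℕ : Filter ℕ) (nhds z) :=
    fun x => ⟨_, ((hyperfilter ℕ).map fun T => cesaro p T x).le_nhds_lim⟩
  choose y hy using hex
  have hpV' : ∀ T : ℕ, 0 < T → ∑' x, cesaro p T x * V x ≤ C := fun T hT => by
    rw [tsum_cesaro_mul]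
    exact hpV T hT
  calc _ ≤ ∑ i, ∑' x, y x * f i x :=
        Finset.sum_le_sum fun i _ => limsup_cesaro_le_tsum hp hV hC hpV' hl hy (hf i)
    _ = ∑' x, y x * ∑ i, f i x := by
        rw [← Summable.tsum_finsetSum fun _ _ => ENNReal.summable]
        simp only [Finset.mul_sum]
    _ ≤ B := by
        refine tsum_mul_le_of_tendsto hy (fun x => ENNReal.sum_ne_top.2 fun i _ => hft i x)
          (hb.mono_left hl) ?_
        filter_upwards [hl (eventually_gt_atTop 0)] with T hT
        rw [tsum_cesaro_mul]
        exact h T hT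

end Chain

/-! ### Stationary randomized policies -/

/-- The mean ages of a request that is served independently with probability `w` in each slot
average to `1 / w`. -/
theorem tendsto_cesaro_of_recurrence {m : ℕ → ℝ≥0∞} {w : ℝ≥0∞} (hw : w ≤ 1) (h0 : m 0 = 1)
    (hm : ∀ n, m (n + 1) + w * m n = m n + 1) :
    Tendsto (fun T : ℕ => (∑ n ∈ Finset.range T, m n) / (T : ℝ≥0∞)) atTop (nhds w⁻¹) := by
  rcases eq_or_ne w 0 with rfl | hw0
  · have hmn : ∀ n : ℕ, m n = n + 1 := by
      intro n
      induction n with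
      | zero => simp [h0]
      | succ n ih =>
        have h := hm n
        rw [zero_mul, add_zero] at h
        rw [h, ih]
        push_cast
        rfl
    have hsum : ∀ T : ℕ, (∑ n ∈ Finset.range T, m n) * 2 = T * (T + 1) := by
      intro T
      induction T with
      | zero => simp
      | succ T ih =>
        rw [Finset.sum_range_succ, add_mul, ih, hmn]
        push_cast
        ring
    have hlim : Tendsto (fun T : ℕ => (2 : ℝ≥0∞)⁻¹ * T) atTop (nhds ((2 : ℝ≥0∞)⁻¹ * ∞)) :=
      ENNReal.Tendsto.const_mul ENNReal.tendsto_nat_nhds_top (Or.inl ENNReal.top_ne_zero)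
    rw [ENNReal.mul_top (by simp)] at hlim
    rw [ENNReal.inv_zero]
    refine tendsto_nhds_top_mono hlim ?_
    filter_upwards [eventually_gt_atTop 0] with T hT
    have hT0 : (T : ℝ≥0∞) ≠ 0 := by exact_mod_cast hT.ne'
    rw [ENNReal.le_div_iff_mul_le (Or.inl hT0) (Or.inl (ENNReal.natCast_ne_top T)), mul_assoc,
      mul_comm, ← div_eq_mul_inv]
    refine ENNReal.div_le_of_le_mul ?_
    rw [hsum]
    gcongr
    exact le_self_add
  · have hwt : w ≠ ∞ := (hw.trans_lt ENNReal.one_lt_top).ne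
    have hle : ∀ n, m n ≤ w⁻¹ := by
      intro n
      induction n with
      | zero => rw [h0]; exact ENNReal.one_le_inv.2 hw
      | succ n ih =>
        have hfin : w * m n ≠ ∞ :=
          ENNReal.mul_ne_top hwt (ih.trans_lt (ENNReal.inv_lt_top.2 (pos_iff_ne_zero.2 hw0))).ne
        have hsplit : m (n + 1) = (1 - w) * m n + 1 := by
          refine (ENNReal.add_left_inj hfin).1 ?_
          rw [hm, add_right_comm, ← add_mul, tsub_add_cancel_of_le hw, one_mul]
        calc m (n + 1) ≤ (1 - w) * w⁻¹ + w * w⁻¹ := by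
              rw [hsplit, ENNReal.mul_inv_cancel hw0 hwt]
              gcongr
          _ = w⁻¹ := by rw [← add_mul, tsub_add_cancel_of_le hw, one_mul]
    have htel : ∀ T : ℕ, m T + w * ∑ n ∈ Finset.range T, m n = T + 1 := by
      intro T
      induction T with
      | zero => simp [h0]
      | succ T ih =>
        rw [Finset.sum_range_succ, mul_add, add_comm (w * _), ← add_assoc, hm, add_right_comm, ih]
        push_cast
        rfl
    have hup : ∀ T : ℕ, 0 < T → (∑ n ∈ Finset.range T, m n) / (T : ℝ≥0∞) ≤ w⁻¹ := by
      intro T hT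
      have hT0 : (T : ℝ≥0∞) ≠ 0 := by exact_mod_cast hT.ne'
      rw [ENNReal.div_le_iff hT0 (ENNReal.natCast_ne_top T), mul_comm]
      exact (Finset.sum_le_sum fun n _ => hle n).trans (by simp)
    have hlow : ∀ T : ℕ, 0 < T → w⁻¹ - w⁻¹ * w⁻¹ / T ≤ (∑ n ∈ Finset.range T, m n) /
        (T : ℝ≥0∞) := by
      intro T hT
      have hT0 : (T : ℝ≥0∞) ≠ 0 := by exact_mod_cast hT.ne'
      have hTt := ENNReal.natCast_ne_top T
      rw [tsub_le_iff_right, ← ENNReal.add_div, ENNReal.le_div_iff_mul_le (Or.inl hT0) (Or.inl hTt)]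
      have h : (T : ℝ≥0∞) ≤ w * (∑ n ∈ Finset.range T, m n) + w⁻¹ := by
        calc (T : ℝ≥0∞) ≤ T + 1 := le_self_add
          _ = m T + w * ∑ n ∈ Finset.range T, m n := (htel T).symm
          _ ≤ _ := by rw [add_comm]; gcongr; exact hle T
      calc w⁻¹ * T ≤ w⁻¹ * (w * (∑ n ∈ Finset.range T, m n) + w⁻¹) := by gcongr
        _ = _ := by rw [mul_add, ← mul_assoc, ENNReal.inv_mul_cancel hw0 hwt, one_mul]
    have hwi : w⁻¹ ≠ ∞ := ENNReal.inv_ne_top.2 hw0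
    have hlim : Tendsto (fun T : ℕ => w⁻¹ - w⁻¹ * w⁻¹ / (T : ℝ≥0∞)) atTop
        (nhds (w⁻¹ - 0)) :=
      ENNReal.Tendsto.sub tendsto_const_nhds
        (tendsto_const_div_natCast (ENNReal.mul_ne_top hwi hwi)) (Or.inl hwi)
    rw [tsub_zero] at hlim
    refine tendsto_of_tendsto_of_tendsto_of_le_of_le' hlim tendsto_const_nhds ?_ ?_
    · filter_upwards [eventually_gt_atTop 0] with T hT using hlow T hT
    · filter_upwards [eventually_gt_atTop 0] with T hT using hup T hT

namespace Switch

variable {N R : ℕ} {S : Switch N R}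

theorem mem_reqs {l : ℕ} {r : Fin R} : r ∈ S.reqs l ↔ (S.G r).card = l := by simp [reqs]

theorem card_mem_cards (r : Fin R) : (S.G r).card ∈ S.cards :=
  Finset.mem_image_of_mem _ (Finset.mem_univ r)

theorem sum_cards_sum_reqs {A : Type*} [AddCommMonoid A] (f : Fin R → A) :
    ∑ l ∈ S.cards, ∑ r ∈ S.reqs l, f r = ∑ r, f r :=
  Finset.sum_fiberwise_of_maps_to (fun r _ => card_mem_cards r) f

/-- The probability that request `r` is served in a slot under an SSR policy. -/
noncomputable def SSR.rate (μ : S.SSR) (r : Fin R) : ℝ≥0∞ :=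
  μ.card (S.G r).card * μ.marg (S.G r).card r * S.success r

theorem SSR.expect_sample (μ : S.SSR) {l : ℕ} (hl : l ∈ S.cards) {r : Fin R}
    (hr : r ∈ S.reqs l) :
    (expect (μ.sample l) fun x => if r ∈ x then 1 else 0) = μ.marg l r := by
  rw [expect, tsum_fintype, ← μ.sample_marg l hl r hr, Finset.sum_filter]
  exact Finset.sum_congr rfl fun x _ => by rw [mul_ite, mul_one, mul_zero]

theorem SSR.serviceProb_toPolicy (μ : S.SSR) (H : History N R) (r : Fin R) :
    μ.toPolicy.serviceProb H r = μ.rate r := by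
  rw [Policy.serviceProb_eq, SSR.rate, mul_comm]
  congr 1
  change expect (μ.card.bind μ.sample) _ = _
  rw [expect_bind, expect, tsum_eq_single (S.G r).card,
    μ.expect_sample (card_mem_cards r) (mem_reqs.2 rfl)]
  intro l hne
  by_cases hl : l ∈ μ.card.support
  · have hl' := μ.card_supp l hl
    have hz : (expect (μ.sample l) fun x => if r ∈ x then 1 else 0) = 0 := by
      refine (expect_congr_on _ fun x hx => if_neg fun hrx => hne ?_).trans
        (expect_const (μ.sample l) 0)
      exact (mem_reqs.1 ((μ.sample_supp l hl' x hx).1 hrx)).symm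
    rw [hz, mul_zero]
  · rw [(PMF.apply_eq_zero_iff _ _).2 hl, zero_mul]

theorem SSR.rate_le_one (μ : S.SSR) (r : Fin R) : μ.rate r ≤ 1 := by
  rw [← μ.serviceProb_toPolicy []]
  exact Policy.serviceProb_le_one _ _ _

theorem Policy.meanAge_zero (π : S.Policy) (r : Fin R) : π.meanAge 0 r = 1 := by
  rw [Policy.meanAge_eq, Policy.expect_law_zero, age_nil, Nat.cast_one]

theorem SSR.tendsto_cesaro_meanAge (μ : S.SSR) (r : Fin R) :
    Tendsto (fun T : ℕ => (∑ n ∈ Finset.range T, μ.toPolicy.meanAge n r) / (T : ℝ≥0∞)) atTop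
      (nhds (μ.rate r)⁻¹) := by
  refine tendsto_cesaro_of_recurrence (μ.rate_le_one r) (Policy.meanAge_zero _ r) fun n => ?_
  simp only [Policy.meanAge_eq]
  rw [Policy.expect_law_succ, ← expect_const_mul, ← expect_add, ← expect_const (μ.toPolicy.law n) 1,
    ← expect_add]
  congr 1
  funext H
  rw [← μ.serviceProb_toPolicy H r, Policy.expect_next_age_id]

theorem SSR.avgAge_toPolicy (μ : S.SSR) :
    μ.toPolicy.avgAge = (∑ r, (μ.rate r)⁻¹) / (R : ℝ≥0∞) := by
  simp only [Policy.avgAge, Policy.reqAge, (μ.tendsto_cesaro_meanAge _).limsup_eq]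

theorem SSR.cards_nonempty (μ : S.SSR) : S.cards.Nonempty := by
  obtain ⟨l, hl⟩ := μ.card.support_nonempty
  exact ⟨l, μ.card_supp l hl⟩

theorem SSR.natCast_ne_zero (μ : S.SSR) : (R : ℝ≥0∞) ≠ 0 := by
  obtain ⟨l, hl⟩ := μ.cards_nonempty
  obtain ⟨r, -, -⟩ := Finset.mem_image.1 hl
  have : 0 < R := r.pos
  exact_mod_cast this.ne'

theorem SSR.netAge_toPolicy (μ : S.SSR) :
    μ.toPolicy.netAge = (∑ r, (μ.rate r)⁻¹) / (R : ℝ≥0∞) := by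
  refine Tendsto.limsup_eq ?_
  have h := ENNReal.Tendsto.mul_const (b := (R : ℝ≥0∞)⁻¹)
    (tendsto_finsetSum Finset.univ fun r _ => μ.tendsto_cesaro_meanAge r)
    (Or.inr (ENNReal.inv_ne_top.2 μ.natCast_ne_zero))
  refine h.congr fun T => ?_
  simp only [div_eq_mul_inv]
  rw [ENNReal.mul_inv (Or.inr (ENNReal.natCast_ne_top R)) (Or.inl (ENNReal.natCast_ne_top T)),
    ← mul_assoc, ← Finset.sum_mul]

end Switch

/-! ### Max-weight policies -/

theorem expect_sum_mem {R : ℕ} (p : PMF (Finset (Fin R))) {C : Finset (Fin R)}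
    (hp : ∀ x ∈ p.support, x ⊆ C) (W : Fin R → ℝ≥0∞) :
    (expect p fun x => ∑ r ∈ x, W r) =
      ∑ r ∈ C, W r * expect p fun x => if r ∈ x then 1 else 0 := by
  simp only [← expect_const_mul]
  rw [← expect_finsetSum]
  refine expect_congr_on p fun x hx => ?_
  simp only [mul_ite, mul_one, mul_zero]
  rw [← Finset.sum_filter, Finset.filter_mem_eq_inter, Finset.inter_eq_right.2 (hp x hx)]

namespace Switch

variable {N R : ℕ} {S : Switch N R}

theorem SSR.marg_ne_zero (μ : S.SSR) {r : Fin R} (h : μ.rate r ≠ 0) :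
    μ.marg (S.G r).card r ≠ 0 := by
  rintro h0
  simp [SSR.rate, h0] at h

/-- A maximum is at least an average: the weight of a max-weight set is at least the mean weight
of the sets sampled by the SSR policy, in which the marginals cancel. -/
theorem SSR.IsMaxWeight.sum_age_le {μ : S.SSR} {H : History N R} {l : ℕ} {x : Finset (Fin R)}
    (hx : μ.IsMaxWeight H l x) (hl : l ∈ S.cards) (hpos : ∀ r ∈ S.reqs l, μ.marg l r ≠ 0) :
    ∑ r ∈ S.reqs l, (age H r : ℝ≥0∞) ≤ ∑ r ∈ x, (((age H r : ℝ≥0) / μ.marg l r : ℝ≥0) : ℝ≥0∞) := by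
  have hsup := fun y hy => (μ.sample_supp l hl y hy)
  calc ∑ r ∈ S.reqs l, (age H r : ℝ≥0∞)
      = ∑ r ∈ S.reqs l, (((age H r : ℝ≥0) / μ.marg l r : ℝ≥0) : ℝ≥0∞) *
          expect (μ.sample l) fun y => if r ∈ y then 1 else 0 := by
        refine Finset.sum_congr rfl fun r hr => ?_
        rw [μ.expect_sample hl hr, ← ENNReal.coe_mul, div_mul_cancel₀ _ (hpos r hr)]
        simp
    _ = expect (μ.sample l) fun y => ∑ r ∈ y, (((age H r : ℝ≥0) / μ.marg l r : ℝ≥0) : ℝ≥0∞) :=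
        (expect_sum_mem _ (fun y hy => (hsup y hy).1) _).symm
    _ ≤ expect (μ.sample l) fun _ => ∑ r ∈ x, (((age H r : ℝ≥0) / μ.marg l r : ℝ≥0) : ℝ≥0∞) := by
        refine expect_mono_on _ fun y hy => ?_
        have h := hx.2 y (hsup y hy).1 (hsup y hy).2
        rw [← ENNReal.ofNNReal_finsetSum, ← ENNReal.ofNNReal_finsetSum, ENNReal.coe_le_coe,
          ← NNReal.coe_le_coe]
        push_cast
        exact h
    _ = _ := expect_const _ _

/-- The max-weight property, averaged over the cardinalities and the outcomes of the services. -/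
theorem Policy.IsSMW.sum_age_le {ψ : S.Policy} {μ : S.SSR} (hψ : ψ.IsSMW μ)
    (hpos : ∀ r, μ.rate r ≠ 0) (H : History N R) :
    ∑ r, (age H r : ℝ≥0∞) ≤ ∑ r, (μ.rate r)⁻¹ * (ψ.serviceProb H r * age H r) := by
  obtain ⟨choice, hmax, hsel⟩ := hψ
  rw [← sum_cards_sum_reqs (S := S), ← sum_cards_sum_reqs (S := S)]
  refine Finset.sum_le_sum fun l hl => ?_
  have hm : ∀ r ∈ S.reqs l, μ.marg l r ≠ 0 := fun r hr => by
    rw [← mem_reqs.1 hr]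
    exact μ.marg_ne_zero (hpos r)
  calc ∑ r ∈ S.reqs l, (age H r : ℝ≥0∞)
      = expect (choice H l) fun _ => ∑ r ∈ S.reqs l, (age H r : ℝ≥0∞) := (expect_const _ _).symm
    _ ≤ expect (choice H l) fun x => ∑ r ∈ x, (((age H r : ℝ≥0) / μ.marg l r : ℝ≥0) : ℝ≥0∞) :=
        expect_mono_on _ fun x hx => (hmax H l hl x hx).sum_age_le hl hm
    _ = ∑ r ∈ S.reqs l, (((age H r : ℝ≥0) / μ.marg l r : ℝ≥0) : ℝ≥0∞) *
          expect (choice H l) fun x => if r ∈ x then 1 else 0 :=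
        expect_sum_mem _ (fun x hx => (hmax H l hl x hx).1.1) _
    _ ≤ _ := by
        refine Finset.sum_le_sum fun r hr => ?_
        obtain rfl := mem_reqs.1 hr
        rw [Policy.serviceProb_eq, hsel, expect_bind]
        set l := (S.G r).card
        set E := expect (choice H l) fun x => if r ∈ x then 1 else 0
        have hc : μ.card l ≠ 0 := fun h => hpos r (by simp [SSR.rate, l, h])
        have hct : μ.card l ≠ ∞ := μ.card.apply_ne_top l
        have hs : (S.success r : ℝ≥0∞) ≠ 0 := by exact_mod_cast (S.success_pos r).ne'
        have hE : μ.card l * E ≤ expect μ.card fun l => expect (choice H l) fun x =>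
            if r ∈ x then 1 else 0 :=
          ENNReal.le_tsum (f := fun l => μ.card l * expect (choice H l) fun x =>
            if r ∈ x then 1 else 0) l
        calc (((age H r : ℝ≥0) / μ.marg l r : ℝ≥0) : ℝ≥0∞) * E
            = (μ.rate r)⁻¹ * (S.success r * (μ.card l * E) * age H r) := by
              have hm0 : (μ.marg l r : ℝ≥0∞) ≠ 0 := by exact_mod_cast hm r hr
              rw [ENNReal.coe_div (hm r hr), div_eq_mul_inv, SSR.rate,
                ENNReal.mul_inv (Or.inr (by simp)) (Or.inr hs),
                ENNReal.mul_inv (Or.inl hc) (Or.inl hct), ENNReal.coe_natCast]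
              calc _ = (age H r : ℝ≥0∞) * (μ.marg l r : ℝ≥0∞)⁻¹ * E *
                    ((μ.card l)⁻¹ * μ.card l) * ((S.success r : ℝ≥0∞)⁻¹ * S.success r) := by
                    rw [ENNReal.inv_mul_cancel hc hct, ENNReal.inv_mul_cancel hs (by simp)]
                    ring
                _ = _ := by ring
          _ ≤ _ := by gcongr

variable {ψ : S.Policy} {μ : S.SSR}

/-- The drift of the Lyapunov function `∑ r, h_r / rate r` under an SMW policy. -/
theorem Policy.IsSMW.sum_cesaro_le (hψ : ψ.IsSMW μ) (hpos : ∀ r, μ.rate r ≠ 0) (T : ℕ) :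
    (∑ n ∈ Finset.range T, expect (ψ.law n) fun H => ∑ r, (age H r : ℝ≥0∞)) ≤
      ∑ r, (μ.rate r)⁻¹ + T * ∑ r, (μ.rate r)⁻¹ := by
  have h := ψ.sum_expect_le_of_drift (F := fun H => ∑ r, (μ.rate r)⁻¹ * age H r)
    (G := fun H => ∑ r, (age H r : ℝ≥0∞)) (C := ∑ r, (μ.rate r)⁻¹) (fun H => ?_) T
  · simpa [age_nil] using h
  · refine (add_le_add_right (hψ.sum_age_le hpos H) _).trans (le_of_eq ?_)
    rw [expect_finsetSum, ← Finset.sum_add_distrib, ← Finset.sum_add_distrib]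
    refine Finset.sum_congr rfl fun r _ => ?_
    rw [expect_const_mul, ← mul_add, ψ.expect_next_age_id, mul_add, mul_one]

theorem Policy.IsSMW.netAge_le (hψ : ψ.IsSMW μ) (hpos : ∀ r, μ.rate r ≠ 0) :
    ψ.netAge ≤ (∑ r, (μ.rate r)⁻¹) / (R : ℝ≥0∞) := by
  set C := ∑ r, (μ.rate r)⁻¹
  have hCt : C ≠ ∞ := ENNReal.sum_ne_top.2 fun r _ => ENNReal.inv_ne_top.2 (hpos r)
  have hlim : Tendsto (fun T : ℕ => (C / (T : ℝ≥0∞) + C) * (R : ℝ≥0∞)⁻¹) atTop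
      (nhds ((0 + C) * (R : ℝ≥0∞)⁻¹)) :=
    ENNReal.Tendsto.mul_const ((tendsto_const_div_natCast hCt).add tendsto_const_nhds)
      (Or.inr (ENNReal.inv_ne_top.2 μ.natCast_ne_zero))
  rw [zero_add, ← div_eq_mul_inv] at hlim
  rw [← hlim.limsup_eq]
  refine limsup_le_limsup ?_
  filter_upwards [eventually_gt_atTop 0] with T hT
  have hT0 : (T : ℝ≥0∞) ≠ 0 := by exact_mod_cast hT.ne'
  have hTt := ENNReal.natCast_ne_top T
  rw [div_eq_mul_inv, ENNReal.mul_inv (Or.inl hT0) (Or.inl hTt), ← mul_assoc]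
  gcongr
  rw [Finset.sum_comm, ← div_eq_mul_inv, ENNReal.div_le_iff hT0 hTt, add_mul,
    ENNReal.div_mul_cancel hT0 hTt, mul_comm C]
  simpa only [expect_finsetSum, ← Policy.meanAge_eq] using hψ.sum_cesaro_le hpos T

/-- The quadratic drift inequality: if `∑ h ≤ ∑ c s h`, the decrease `∑ s h²` caused by services
dominates a multiple of `∑ h²`, by the Cauchy-Schwarz inequality. -/
theorem sum_quadratic_drift_le {ι : Type*} [Fintype ι] {h s c e : ι → ℝ} {K : ℝ}
    (hh : ∀ i, 0 ≤ h i) (hs : ∀ i, 0 ≤ s i) (hs1 : ∀ i, s i ≤ 1) (hK : 0 < K)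
    (hcK : ∑ i, c i ^ 2 ≤ K) (hw : ∑ i, h i ≤ ∑ i, c i * (s i * h i))
    (he : ∀ i, e i + s i * (h i + 1) ^ 2 = s i + (h i + 1) ^ 2) :
    ∑ i, e i + (2 * K)⁻¹ * ∑ i, h i ^ 2 ≤ ∑ i, h i ^ 2 + Fintype.card ι * (2 * K + 1) := by
  have hcs : (∑ i, c i * (s i * h i)) ^ 2 ≤ (∑ i, c i ^ 2 * s i) * ∑ i, s i * h i ^ 2 :=
    Finset.sum_sq_le_sum_mul_sum_of_sq_le_mul _ (fun i _ => mul_nonneg (sq_nonneg _) (hs i))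
      (fun i _ => mul_nonneg (hs i) (sq_nonneg _)) fun i _ => le_of_eq (by ring)
  have hcs' : ∑ i, c i ^ 2 * s i ≤ K :=
    (Finset.sum_le_sum fun i _ => mul_le_of_le_one_right (sq_nonneg _) (hs1 i)).trans hcK
  have hsh : 0 ≤ ∑ i, s i * h i ^ 2 :=
    Finset.sum_nonneg fun i _ => mul_nonneg (hs i) (sq_nonneg _)
  have hsum : 0 ≤ ∑ i, h i := Finset.sum_nonneg fun i _ => hh i
  have hsq : ∑ i, h i ^ 2 ≤ (∑ i, h i) ^ 2 :=
    Finset.sum_sq_le_sq_sum_of_nonneg fun i _ => hh i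
  have hmain : K⁻¹ * ∑ i, h i ^ 2 ≤ ∑ i, s i * h i ^ 2 := by
    rw [inv_mul_le_iff₀ hK]
    calc _ ≤ (∑ i, h i) ^ 2 := hsq
      _ ≤ (∑ i, c i * (s i * h i)) ^ 2 := pow_le_pow_left₀ hsum hw 2
      _ ≤ _ := hcs.trans (mul_le_mul_of_nonneg_right hcs' hsh)
  have hpt : ∀ i, e i ≤ h i ^ 2 + ((2 * K)⁻¹ * h i ^ 2 + (2 * K + 1)) - s i * h i ^ 2 := by
    intro i
    have h1 : 2 * h i ≤ (2 * K)⁻¹ * h i ^ 2 + 2 * K := by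
      have h2 : 0 ≤ (2 * K)⁻¹ * (h i - 2 * K) ^ 2 := by positivity
      have h3 : (2 * K)⁻¹ * (h i - 2 * K) ^ 2 = (2 * K)⁻¹ * h i ^ 2 + 2 * K - 2 * h i := by
        field_simp
        ring
      linarith
    have h4 := he i
    have h5 : 0 ≤ s i * h i := mul_nonneg (hs i) (hh i)
    nlinarith
  have hfin := Finset.sum_le_sum fun i (_ : i ∈ Finset.univ) => hpt i
  rw [Finset.sum_sub_distrib, Finset.sum_add_distrib, Finset.sum_add_distrib, ← Finset.mul_sum,
    Finset.sum_const, Finset.card_univ, nsmul_eq_mul] at hfin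
  have hhalf : K⁻¹ * ∑ i, h i ^ 2 = 2 * ((2 * K)⁻¹ * ∑ i, h i ^ 2) := by
    field_simp
  linarith

/-- Under an SMW policy, the time averages of the second moments of the ages are bounded. -/
theorem Policy.IsSMW.exists_cesaro_sq_le (hψ : ψ.IsSMW μ) (hpos : ∀ r, μ.rate r ≠ 0) :
    ∃ C : ℝ≥0∞, C ≠ ∞ ∧ ∀ T : ℕ, 0 < T →
      (∑ n ∈ Finset.range T, expect (ψ.law n) fun H => ∑ r, (age H r : ℝ≥0∞) ^ 2) /
        (T : ℝ≥0∞) ≤ C := by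
  set K : ℝ := ∑ r, ((μ.rate r)⁻¹).toReal ^ 2 + 1 with hKdef
  have hK : 0 < K := by positivity
  set δ := ENNReal.ofReal (2 * K)⁻¹ with hδ
  set D := ENNReal.ofReal (R * (2 * K + 1)) with hD
  have hδ0 : δ ≠ 0 := by
    rw [hδ, Ne, ENNReal.ofReal_eq_zero, not_le]
    positivity
  have hdrift : ∀ H, (expect (ψ.next H) fun s => ∑ r, (age (s :: H) r : ℝ≥0∞) ^ 2) +
      δ * ∑ r, (age H r : ℝ≥0∞) ^ 2 ≤ ∑ r, (age H r : ℝ≥0∞) ^ 2 + D := by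
    intro H
    set e := fun r => expect (ψ.next H) fun s => (age (s :: H) r : ℝ≥0∞) ^ 2
    have hst : ∀ r, ψ.serviceProb H r ≠ ∞ := fun r =>
      ((ψ.serviceProb_le_one H r).trans_lt ENNReal.one_lt_top).ne
    have hid : ∀ r, e r + ψ.serviceProb H r * ((age H r : ℝ≥0∞) + 1) ^ 2 =
        ψ.serviceProb H r + ((age H r : ℝ≥0∞) + 1) ^ 2 := by
      intro r
      have h := ψ.expect_next_age H r fun n => (n : ℝ≥0∞) ^ 2
      push_cast at h
      rwa [one_pow, mul_one] at h
    have hsqt : ∀ r, ((age H r : ℝ≥0∞) + 1) ^ 2 ≠ ∞ := fun r =>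
      ENNReal.pow_ne_top (ENNReal.add_ne_top.2 ⟨ENNReal.natCast_ne_top _, ENNReal.one_ne_top⟩)
    have het : ∀ r, e r ≠ ∞ := fun r => by
      refine ne_top_of_le_ne_top (ENNReal.add_ne_top.2 ⟨hst r, hsqt r⟩) ?_
      exact le_self_add.trans (hid r).le
    have hct : ∀ r, (μ.rate r)⁻¹ ≠ ∞ := fun r => ENNReal.inv_ne_top.2 (hpos r)
    have hreal := sum_quadratic_drift_le (h := fun r => (age H r : ℝ))
      (s := fun r => (ψ.serviceProb H r).toReal) (c := fun r => ((μ.rate r)⁻¹).toReal)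
      (e := fun r => (e r).toReal) (K := K) (fun r => Nat.cast_nonneg _)
      (fun r => ENNReal.toReal_nonneg)
      (fun r => ENNReal.toReal_le_of_le_ofReal zero_le_one
        ((ψ.serviceProb_le_one H r).trans ENNReal.ofReal_one.ge)) hK (by rw [hKdef]; linarith) ?_ ?_
    · rw [expect_finsetSum]
      have h1 : ∑ r, e r = ENNReal.ofReal (∑ r, (e r).toReal) := by
        rw [← ENNReal.toReal_sum fun r _ => het r,
          ENNReal.ofReal_toReal (ENNReal.sum_ne_top.2 fun r _ => het r)]
      have h2 : ∑ r, (age H r : ℝ≥0∞) ^ 2 = ENNReal.ofReal (∑ r, (age H r : ℝ) ^ 2) := by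
        rw [ENNReal.ofReal_sum_of_nonneg fun r _ => sq_nonneg _]
        refine Finset.sum_congr rfl fun r _ => ?_
        rw [ENNReal.ofReal_pow (Nat.cast_nonneg _), ENNReal.ofReal_natCast]
      rw [h1, h2, hδ, hD, ← ENNReal.ofReal_mul (by positivity), ← ENNReal.ofReal_add,
        ← ENNReal.ofReal_add]
      · refine ENNReal.ofReal_le_ofReal ?_
        simpa using hreal
      all_goals positivity
    · have h := ENNReal.toReal_mono (ENNReal.sum_ne_top.2 fun r _ => ENNReal.mul_ne_top (hct r)
        (ENNReal.mul_ne_top (hst r) (ENNReal.natCast_ne_top _))) (hψ.sum_age_le hpos H)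
      rw [ENNReal.toReal_sum fun r _ => ENNReal.natCast_ne_top _,
        ENNReal.toReal_sum fun r _ => ENNReal.mul_ne_top (hct r)
        (ENNReal.mul_ne_top (hst r) (ENNReal.natCast_ne_top _))] at h
      simpa only [ENNReal.toReal_mul, ENNReal.toReal_natCast] using h
    · intro r
      have h := congrArg ENNReal.toReal (hid r)
      rw [ENNReal.toReal_add (het r) (ENNReal.mul_ne_top (hst r) (hsqt r)),
        ENNReal.toReal_add (hst r) (hsqt r), ENNReal.toReal_mul, ENNReal.toReal_pow,
        ENNReal.toReal_add (ENNReal.natCast_ne_top _) ENNReal.one_ne_top,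
        ENNReal.toReal_natCast, ENNReal.toReal_one] at h
      exact h
  refine ⟨δ⁻¹ * (R + D), ENNReal.mul_ne_top (ENNReal.inv_ne_top.2 hδ0)
    (ENNReal.add_ne_top.2 ⟨ENNReal.natCast_ne_top _, ENNReal.ofReal_ne_top⟩), fun T hT => ?_⟩
  have hT0 : (T : ℝ≥0∞) ≠ 0 := by exact_mod_cast hT.ne'
  have h := ψ.sum_expect_le_of_drift hdrift T
  simp only [expect_const_mul] at h
  rw [← Finset.mul_sum] at h
  rw [ENNReal.div_le_iff hT0 (ENNReal.natCast_ne_top T), mul_assoc,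
    ← ENNReal.mul_le_iff_le_inv hδ0 ENNReal.ofReal_ne_top]
  refine h.trans ?_
  rw [add_mul, mul_comm D]
  gcongr
  simp only [age_nil, Nat.cast_one, one_pow, Finset.sum_const, Finset.card_univ, Fintype.card_fin,
    nsmul_eq_mul, mul_one]
  exact le_mul_of_one_le_right zero_le (by exact_mod_cast hT)

/-- The transition kernel of the ages under an age-based policy. The past that is used to look up
the selection probabilities is immaterial; vectors that are not the ages of any history stay
put. -/
noncomputable def ageKernel (ψ : S.Policy) (a : Fin R → ℕ) : PMF (Fin R → ℕ) :=
  open Classical in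
  if h : ∃ H : History N R, age H = a then
    (ψ.next h.choose).map fun s r => if r ∈ s.served then 1 else a r + 1
  else PMF.pure a

theorem Policy.IsAgeBased.map_law_succ (hψ : ψ.IsAgeBased) (n : ℕ) :
    (ψ.law (n + 1)).map age = ((ψ.law n).map age).bind (ageKernel ψ) := by
  rw [Policy.law_succ, PMF.map_bind, PMF.bind_map]
  congr 1
  funext H
  have hex : ∃ H' : History N R, age H' = age H := ⟨H, rfl⟩
  rw [Function.comp_apply, ageKernel, dif_pos hex, PMF.map_comp]
  have hnext : ψ.next hex.choose = ψ.next H := by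
    rw [Policy.next, Policy.next, hψ _ _ hex.choose_spec]
  rw [hnext]
  congr 1
  funext s r
  exact age_cons s H r

theorem finite_setOf_sum_sq_le {ι : Type*} [Fintype ι] (L : ℕ) :
    {a : ι → ℕ | ∑ i, (a i : ℝ≥0∞) ^ 2 ≤ L}.Finite := by
  refine (Set.Finite.pi' fun _ : ι => Set.finite_Iic L).subset fun a ha i => ?_
  have h : ((a i : ℝ≥0∞)) ^ 2 ≤ L :=
    (Finset.single_le_sum (f := fun i => (a i : ℝ≥0∞) ^ 2) (fun _ _ => zero_le)
      (Finset.mem_univ i)).trans ha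
  have h' : a i ^ 2 ≤ L := by exact_mod_cast h
  exact (Nat.le_self_pow two_ne_zero _).trans h'

theorem Policy.IsSMW.avgAge_le (hψ : ψ.IsSMW μ) (hpos : ∀ r, μ.rate r ≠ 0)
    (hage : ψ.IsAgeBased) : ψ.avgAge ≤ (∑ r, (μ.rate r)⁻¹) / (R : ℝ≥0∞) := by
  set C := ∑ r, (μ.rate r)⁻¹
  have hCt : C ≠ ∞ := ENNReal.sum_ne_top.2 fun r _ => ENNReal.inv_ne_top.2 (hpos r)
  obtain ⟨K, hK, hsq⟩ := hψ.exists_cesaro_sq_le hpos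
  have hlim : Tendsto (fun T : ℕ => C / (T : ℝ≥0∞) + C) atTop (nhds (0 + C)) :=
    (tendsto_const_div_natCast hCt).add tendsto_const_nhds
  rw [zero_add] at hlim
  have h := sum_limsup_cesaro_le (p := fun n => (ψ.law n).map age) hage.map_law_succ
    (V := fun a => ∑ r, (a r : ℝ≥0∞) ^ 2) finite_setOf_sum_sq_le hK
    (fun T hT => by simpa only [expect_map] using hsq T hT)
    (f := fun r a => (a r : ℝ≥0∞))
    (fun r a => Finset.single_le_sum (f := fun r => (a r : ℝ≥0∞) ^ 2) (fun _ _ => zero_le)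
      (Finset.mem_univ r))
    (fun r a => ENNReal.natCast_ne_top _) hlim ?_
  · rw [Policy.avgAge]
    gcongr
    simpa only [expect_map, Policy.reqAge, Policy.meanAge_eq] using h
  · intro T hT
    have hT0 : (T : ℝ≥0∞) ≠ 0 := by exact_mod_cast hT.ne'
    have hTt := ENNReal.natCast_ne_top T
    rw [ENNReal.div_le_iff hT0 hTt, add_mul, ENNReal.div_mul_cancel hT0 hTt, mul_comm C]
    simpa only [expect_map] using hψ.sum_cesaro_le hpos T

theorem SSR.sum_inv_rate_eq_top (μ : S.SSR) (h : ¬ ∀ r, μ.rate r ≠ 0) :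
    (∑ r, (μ.rate r)⁻¹) / (R : ℝ≥0∞) = ∞ := by
  push Not at h
  obtain ⟨r, hr⟩ := h
  have hsum : ∑ r, (μ.rate r)⁻¹ = ∞ :=
    ENNReal.sum_eq_top.2 ⟨r, Finset.mem_univ r, by rw [hr, ENNReal.inv_zero]⟩
  rw [hsum, ENNReal.top_div_of_ne_top (ENNReal.natCast_ne_top R)]

end Switch

/-! ### Optimality of the closed form -/

namespace Switch

variable {N R : ℕ} {S : Switch N R}

/-- The tangent-line inequality for `x ↦ 1 / (x v)` at the water-filling point
`min 1 (1 / √(γ v))`: the slope there is `-γ`, or steeper where the cap `1` is active. -/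
theorem one_div_min_le {γ v x : ℝ} (hγ : 0 < γ) (hv : 0 < v) (hx : 0 < x) (hx1 : x ≤ 1) :
    1 / (min 1 (1 / √(γ * v)) * v) + γ * min 1 (1 / √(γ * v)) ≤ 1 / (x * v) + γ * x := by
  have hgv : 0 < γ * v := mul_pos hγ hv
  have hs : 0 < √(γ * v) := Real.sqrt_pos.2 hgv
  have hsq : √(γ * v) ^ 2 = γ * v := Real.sq_sqrt hgv.le
  set s := √(γ * v)
  have hγe : γ = s ^ 2 / v := by rw [hsq]; field_simp
  rcases le_total s 1 with h | h
  · rw [min_eq_left ((one_le_div hs).2 h), hγe]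
    have h1 : 1 / (x * v) + s ^ 2 / v * x - (1 / (1 * v) + s ^ 2 / v * 1) =
        (1 - x) * (1 - s ^ 2 * x) / (x * v) := by
      field_simp
      ring
    have h2 : s ^ 2 * x ≤ 1 := mul_le_one₀ (pow_le_one₀ hs.le h) hx.le hx1
    have h3 : 0 ≤ (1 - x) * (1 - s ^ 2 * x) / (x * v) :=
      div_nonneg (mul_nonneg (by linarith) (by linarith)) (mul_pos hx hv).le
    linarith
  · rw [min_eq_right ((div_le_one hs).2 h), hγe]
    have h1 : 1 / (x * v) + s ^ 2 / v * x - (1 / (1 / s * v) + s ^ 2 / v * (1 / s)) =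
        (1 - s * x) ^ 2 / (x * v) := by
      field_simp
      ring
    have h3 : 0 ≤ (1 - s * x) ^ 2 / (x * v) := div_nonneg (sq_nonneg _) (mul_pos hx hv).le
    linarith

theorem SSR.IsClosedForm.marg_pos {μ : S.SSR} (hμ : μ.IsClosedForm) {l : ℕ} (hl : l ∈ S.cards)
    {r : Fin R} (hr : r ∈ S.reqs l) : 0 < (μ.marg l r : ℝ) := by
  rcases (min_le_left _ _ : S.cap l ≤ (S.reqs l).card).lt_or_eq with h | h
  · obtain ⟨γ, hγ, -, hm⟩ := hμ.1 l hl h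
    rw [hm r hr]
    have hv : 0 < (S.v r : ℝ) := S.v_pos r
    exact lt_min one_pos (by positivity)
  · rw [hμ.2.1 l hl h r hr]
    simp

/-- Within a cardinality class, the closed-form marginals minimize `∑ 1 / (μ(r) v(r))`. -/
theorem SSR.IsClosedForm.f_le {μ : S.SSR} (hμ : μ.IsClosedForm) (μ' : S.SSR) {l : ℕ}
    (hl : l ∈ S.cards) (hpos : ∀ r ∈ S.reqs l, 0 < (μ'.marg l r : ℝ)) : μ.f l ≤ μ'.f l := by
  have hle : ∀ r ∈ S.reqs l, (μ'.marg l r : ℝ) ≤ 1 := fun r hr => μ'.marg_le l hl r hr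
  rcases (min_le_left _ _ : S.cap l ≤ (S.reqs l).card).lt_or_eq with h | h
  · obtain ⟨γ, hγ, hsum, hm⟩ := hμ.1 l hl h
    have hpt := Finset.sum_le_sum fun r hr =>
      one_div_min_le hγ (show 0 < (S.v r : ℝ) from S.v_pos r) (hpos r hr) (hle r hr)
    have hsum' : ∑ r ∈ S.reqs l, (μ'.marg l r : ℝ) = S.cap l := by
      exact_mod_cast μ'.marg_sum l hl
    rw [Finset.sum_add_distrib, Finset.sum_add_distrib, ← Finset.mul_sum, ← Finset.mul_sum, hsum,
      hsum'] at hpt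
    have hf : μ.f l = ∑ r ∈ S.reqs l, 1 / (min 1 (1 / √(γ * S.v r)) * (S.v r : ℝ)) :=
      Finset.sum_congr rfl fun r hr => by rw [hm r hr]
    rw [hf, SSR.f]
    linarith
  · refine Finset.sum_le_sum fun r hr => ?_
    have hv : 0 < (S.v r : ℝ) := S.v_pos r
    rw [hμ.2.1 l hl h r hr]
    refine one_div_le_one_div_of_le (mul_pos (hpos r hr) hv) ?_
    exact mul_le_mul_of_nonneg_right (hle r hr) hv.le

theorem SSR.card_sum (μ : S.SSR) : ∑ l ∈ S.cards, (μ.card l).toReal = 1 := by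
  have h : ∑' l, μ.card l = ∑ l ∈ S.cards, μ.card l := tsum_eq_sum fun l hl => by
    by_contra h
    exact hl (μ.card_supp l ((PMF.mem_support_iff _ _).2 h))
  rw [← ENNReal.toReal_sum fun l _ => μ.card.apply_ne_top l, ← h, PMF.tsum_coe,
    ENNReal.toReal_one]

/-- The sum of the mean ages is `∑ f_l / (q_l μ⁽⁰⁾(l))` if all requests are selected with positive
probability. -/
theorem SSR.sum_inv_rate (μ : S.SSR) (hpos : ∀ r, μ.rate r ≠ 0) :
    ∑ r, (μ.rate r)⁻¹ =
      ENNReal.ofReal (∑ l ∈ S.cards, μ.f l / S.q l / (μ.card l).toReal) := by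
  have hterm : ∀ l ∈ S.cards, μ.f l / S.q l / (μ.card l).toReal =
      ∑ r ∈ S.reqs l, ((μ.rate r)⁻¹).toReal := by
    intro l _
    rw [SSR.f, Finset.sum_div, Finset.sum_div]
    refine Finset.sum_congr rfl fun r hr => ?_
    obtain rfl := mem_reqs.1 hr
    simp only [SSR.rate, success, ENNReal.toReal_inv, ENNReal.toReal_mul, ENNReal.coe_toReal,
      NNReal.coe_mul, div_eq_mul_inv, mul_inv]
    ring
  rw [Finset.sum_congr rfl hterm, sum_cards_sum_reqs,
    ← ENNReal.toReal_sum fun r _ => ENNReal.inv_ne_top.2 (hpos r),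
    ENNReal.ofReal_toReal (ENNReal.sum_ne_top.2 fun r _ => ENNReal.inv_ne_top.2 (hpos r))]

theorem SSR.card_pos (μ : S.SSR) (hpos : ∀ r, μ.rate r ≠ 0) {l : ℕ} (hl : l ∈ S.cards) :
    0 < (μ.card l).toReal := by
  obtain ⟨r, -, rfl⟩ := Finset.mem_image.1 hl
  refine ENNReal.toReal_pos (fun h => hpos r ?_) (μ.card.apply_ne_top _)
  rw [SSR.rate, h, zero_mul, zero_mul]

theorem q_pos_of_mem_cards {l : ℕ} (hl : l ∈ S.cards) : 0 < (S.q l : ℝ) := by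
  obtain ⟨r, -, rfl⟩ := Finset.mem_image.1 hl
  exact S.q_pos r

theorem SSR.IsClosedForm.f_pos {μ : S.SSR} (hμ : μ.IsClosedForm) {l : ℕ} (hl : l ∈ S.cards) :
    0 < μ.f l := by
  obtain ⟨r, -, hr⟩ := Finset.mem_image.1 hl
  refine Finset.sum_pos (fun r hr => ?_) ⟨r, mem_reqs.2 hr⟩
  have hv : 0 < (S.v r : ℝ) := S.v_pos r
  exact one_div_pos.2 (mul_pos (hμ.marg_pos hl hr) hv)

theorem SSR.IsClosedForm.rate_ne_zero {μ : S.SSR} (hμ : μ.IsClosedForm) (r : Fin R) :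
    μ.rate r ≠ 0 := by
  have hl := card_mem_cards (S := S) r
  have hcard : μ.card (S.G r).card ≠ 0 := by
    intro h
    have h2 := hμ.2.2 _ hl
    rw [h, ENNReal.toReal_zero] at h2
    refine (div_pos (Real.sqrt_pos.2 (div_pos (hμ.f_pos hl) (q_pos_of_mem_cards hl)))
      (Finset.sum_pos (fun l hl' => ?_) ⟨_, hl⟩)).ne h2
    exact Real.sqrt_pos.2 (div_pos (hμ.f_pos hl') (q_pos_of_mem_cards hl'))
  have hm : μ.marg (S.G r).card r ≠ 0 := by
    have := hμ.marg_pos hl (mem_reqs.2 rfl : r ∈ S.reqs _)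
    exact_mod_cast this.ne'
  rw [SSR.rate]
  refine mul_ne_zero (mul_ne_zero hcard ?_) ?_
  · exact_mod_cast hm
  · exact_mod_cast (S.success_pos r).ne'

/-- The closed form is optimal: by the tangent-line inequality within each class and the
Cauchy-Schwarz inequality across the classes. -/
theorem SSR.IsClosedForm.isOptimal {μ : S.SSR} (hμ : μ.IsClosedForm) : μ.IsOptimal := by
  intro μ'
  rw [SSR.avgAge_toPolicy, SSR.avgAge_toPolicy]
  by_cases hpos : ∀ r, μ'.rate r ≠ 0
  swap
  · rw [μ'.sum_inv_rate_eq_top hpos]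
    exact le_top
  gcongr ?_ / _
  rw [μ.sum_inv_rate hμ.rate_ne_zero, μ'.sum_inv_rate hpos]
  refine ENNReal.ofReal_le_ofReal ?_
  set a := fun l => √(μ.f l / S.q l)
  have hapos : ∀ l ∈ S.cards, 0 < a l := fun l hl =>
    Real.sqrt_pos.2 (div_pos (hμ.f_pos hl) (q_pos_of_mem_cards hl))
  have hasq : ∀ l ∈ S.cards, μ.f l / S.q l = a l ^ 2 := fun l hl =>
    (Real.sq_sqrt (div_pos (hμ.f_pos hl) (q_pos_of_mem_cards hl)).le).symm
  calc ∑ l ∈ S.cards, μ.f l / S.q l / (μ.card l).toReal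
      = ∑ l ∈ S.cards, a l * ∑ l' ∈ S.cards, a l' := by
        refine Finset.sum_congr rfl fun l hl => ?_
        have h0 := hapos l hl
        have hcard : (μ.card l).toReal = a l / ∑ l' ∈ S.cards, a l' := hμ.2.2 l hl
        rw [hcard, hasq l hl, div_div_eq_mul_div]
        field_simp
    _ = (∑ l ∈ S.cards, a l) ^ 2 / ∑ l ∈ S.cards, (μ'.card l).toReal := by
        rw [← Finset.sum_mul, μ'.card_sum, div_one, sq]
    _ ≤ ∑ l ∈ S.cards, a l ^ 2 / (μ'.card l).toReal :=
        Finset.sq_sum_div_le_sum_sq_div _ _ fun l hl => μ'.card_pos hpos hl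
    _ ≤ ∑ l ∈ S.cards, μ'.f l / S.q l / (μ'.card l).toReal := by
        refine Finset.sum_le_sum fun l hl => ?_
        rw [← hasq l hl]
        have hq := q_pos_of_mem_cards hl
        have hf : μ.f l ≤ μ'.f l := hμ.f_le μ' hl fun r hr => by
          rw [← mem_reqs.1 hr]
          exact NNReal.coe_pos.2 (pos_iff_ne_zero.2 (μ'.marg_ne_zero (hpos r)))
        gcongr

end Switch

end QSwitch

/-- The closed-form expressions describe an optimal SSR policy, and, for every optimal SSR policy
`μ`, every SMW policy `ψ` with the parameters of `μ` performs no worse than `μ`: with the time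
averages of the overall age for all tie-breaking rules, and with the sum of the average ages of
the requests if ties are broken on the basis of the current ages. -/
theorem theorem2 {N R : ℕ} (S : QSwitch.Switch N R) (μ : S.SSR) :
    (μ.IsClosedForm → μ.IsOptimal) ∧
    (μ.IsOptimal → ∀ ψ : S.Policy, ψ.IsSMW μ →
      ψ.netAge ≤ μ.toPolicy.netAge ∧
      (ψ.IsAgeBased → ψ.avgAge ≤ μ.toPolicy.avgAge)) := by
  refine ⟨fun h => h.isOptimal, fun _ ψ hψ => ?_⟩
  rw [μ.netAge_toPolicy, μ.avgAge_toPolicy]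
  by_cases hpos : ∀ r, μ.rate r ≠ 0
  · exact ⟨hψ.netAge_le hpos, hψ.avgAge_le hpos⟩
  · -- a request that is never selected makes the age of the SSR policy infinite
    rw [μ.sum_inv_rate_eq_top hpos]
    exact ⟨le_top, fun _ => le_top⟩
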